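/- **Conventions.** All graphs are finite multigraphs. For a graph $G$ and $T\subseteq V(G)$, a *join* of $(G,T)$ is a set $F\subseteq E(G)$ such that the number of edges of $F$ in the cut $\delta_G(v)$ is odd for each $v\in T$ and even for each $v\in V(G)\setminus T$. The pair $(G,T)$ is a *graft* if $|V(C)\cap T|$ is even for every connected component $C$ of $G$ (equivalently, it has a join). $\nu(G,T)$ denotes the number of edges of a minimum join. We write $T\Delta\{u,v\}$ for $T\Delta\{u\}\Delta\{v\}$, so $T\Delta\{u,v\}=T$ if $u=v$. **Factor-components.** An edge of a graft $(G,T)$ is *allowed* if it lies in some minimum join. Two vertices are *factor-connected* if they are joined by a path (possibly trivial) consisting of allowed edges. The *factor-components* of $(G,T)$ are the subgraphs of $G$ induced by the equivalence classes of this relation; their set is $\mathcal{G}(G,T)$. A set $X\subseteq V(G)$ is *separating* if it is a union of vertex sets of factor-components. **Contraction.** For $X\subseteq V(G)$, the graft $(G,T)/X$ is obtained by deleting the edges with both ends in $X$ and identifying $X$ to a single vertex, which belongs to the new terminal set if and only if $|X\cap T|$ is odd; the other terminals are those of $T\setminus X$. For a separating set $X$, $(G,T)[X]=(G[X],T\cap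 X)$. **Combs and quasicombs.** Let $(G,T;A,B)$ be a bipartite graft with color classes $A$ and $B$ (in this order). It is a *comb*, with *spine set* $A$ and *tooth set* $B$, if $B\subseteq T$ and $\nu(G,T)=|B|$. It is a *quasicomb*, with spine set $A$ and tooth set $B$, if $\nu(G,T)=|B\cap T|$. A quasicomb is *critical* with *root* $r\in B$ if for every vertex $x$ the pair $(G,T\Delta\{x,r\})$ is a graft, with $\nu(G,T\Delta\{x,r\})-\nu(G,T)=1$ for each $x\in A$ and $\nu(G,T\Delta\{x,r\})-\nu(G,T)=0$ for each $x\in B$. **The order $\preceq$.** Let $(G,T;A,B)$ be a comb and $G_0$ a factor-component. A set $X\subseteq V(G)$ is *critical* for $G_0$ if $X$ is separating, $V(G_0)\subseteq X$, and $(G,T)[X]/V(G_0)$, with contracted vertex $g_0$, is a critical quasicomb with root $g_0$, spine set $(A\cap X)\setminus V(G_0)$ and tooth set $((B\cap X)\setminus V(G_0))\cup\{g_0\}$. For factor-components $G_1,G_2$ write $G_1\preceq G_2$ if there is a critical set $X$ for $G_1$ with $V(G_2)\subseteq X$. **The general Kotzig–Lovász decomposition.** For vertices $u,v$ of a graft $(G,T)$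 let $u\sim v$ if $u=v$, or if $u$ and $v$ lie in the same factor-component and $\nu(G,T\Delta\{u,v\})=\nu(G,T)$. This is an equivalence relation. For a factor-component $H$, let $\mathcal{P}(G,T;H)$ be the set of its classes that meet $V(H)$; they partition $V(H)$. **Theorem.** Let $(G,T;A,B)$ be a comb, and let $G_0\in\mathcal{G}(G,T)$. Let $U$ be the union of $V(H)$ over all factor-components $H\neq G_0$ with $G_0\preceq H$, and let $K$ be a connected component of $G[U]$. Then there exists $S\in\mathcal{P}(G,T;G_0)$ with $S\subseteq B$ such that $N_G(V(K))\cap V(G_0)\subseteq S$, where $N_G(V(K))$ is the set of vertices outside $K$ adjacent to a vertex of $K$. -/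

import Mathlib

open scoped Graph symmDiff

namespace Grafts

/-! ### Cuts, neighbours, connected components -/

/-- `δ_G(X)`: the edges of `G` with exactly one end in `X` (in particular, no loops). -/
def cut {α β : Type*} (G : Graph α β) (X : Set α) : Set β :=
  {e | ∃ x y, G.IsLink e x y ∧ x ∈ X ∧ y ∉ X}

/-- `N_G(X)`: the vertices outside `X` that are adjacent to a vertex of `X`. -/
def neighbors {α β : Type*} (G : Graph α β) (X : Set α) : Set α :=
  {y | y ∉ X ∧ ∃ x ∈ X, G.Adj x y}

/-- The connected components of `G`, as subgraphs of `G`. -/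
def connectedComponents {α β : Type*} (G : Graph α β) : Set (Graph α β) :=
  {C | ∃ v ∈ V(G), C = G.induce {u | Relation.ReflTransGen G.Adj v u}}

/-! ### Grafts and joins -/

/-- `F` is a join of `(G, T)`. -/
def IsJoin {α β : Type*} (G : Graph α β) (T : Set α) (F : Set β) : Prop :=
  F ⊆ E(G) ∧ ∀ v ∈ V(G), (Odd (cut G {v} ∩ F).ncard ↔ v ∈ T)

/-- `(G, T)` is a graft. -/
def IsGraft {α β : Type*} (G : Graph α β) (T : Set α) : Prop :=
  T ⊆ V(G) ∧ ∀ C ∈ connectedComponents G, Even (V(C) ∩ T).ncard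

/-- `F` is a join of `(G, T)` with the minimum number of edges. -/
def IsMinJoin {α β : Type*} (G : Graph α β) (T : Set α) (F : Set β) : Prop :=
  IsJoin G T F ∧ ∀ F' : Set β, IsJoin G T F' → F.encard ≤ F'.encard

/-- `ν(G, T)`: the number of edges in a minimum join of `(G, T)`. The value is `⊤` if there is
no join. -/
noncomputable def nu {α β : Type*} (G : Graph α β) (T : Set α) : ℕ∞ :=
  ⨅ (F : Set β) (_ : IsJoin G T F), F.encard

/-- `T ∆ {u, v}` if `u ≠ v`, and `T` if `u = v`. -/
def toggle {α : Type*} (T : Set α) (u v : α) : Set α := T ∆ {u} ∆ {v}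

/-! ### Factor-components -/

/-- The allowed edges of `(G, T)`: those contained in some minimum join. -/
def allowedEdges {α β : Type*} (G : Graph α β) (T : Set α) : Set β :=
  {e | ∃ F, IsMinJoin G T F ∧ e ∈ F}

/-- `u` and `v` are joined by a path all of whose edges are allowed. -/
def FactorConnected {α β : Type*} (G : Graph α β) (T : Set α) (u v : α) : Prop :=
  u ∈ V(G) ∧ Relation.ReflTransGen (G.restrict (allowedEdges G T)).Adj u v

/-- The factor-components of `(G, T)`: the subgraphs induced by the classes of
factor-connected vertices. -/
def factorComponents {α β : Type*} (G : Graph α β) (T : Set α) : Set (Graph α β) :=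
  {H | ∃ v ∈ V(G), H = G.induce {u | FactorConnected G T v u}}

/-- `X` is a union of vertex sets of factor-components. -/
def IsSeparating {α β : Type*} (G : Graph α β) (T : Set α) (X : Set α) : Prop :=
  ∃ 𝓗 ⊆ factorComponents G T, X = ⋃ H ∈ 𝓗, V(H)

/-! ### Contraction -/

open Classical in
/-- The vertex map of the contraction of `X`; the contracted vertex is `none`. -/
noncomputable def contractVertex {α : Type*} (X : Set α) (x : α) : Option α :=
  if x ∈ X then none else some x

/-- The graph `G / X`: the edges with both ends in `X` disappear, and the vertices of `X` are
identified to the single vertex `none`. -/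
noncomputable def contract {α β : Type*} (G : Graph α β) (X : Set α) : Graph (Option α) β :=
  (G.deleteEdges E(G.induce X)).map (contractVertex X)

/-- The terminal set of the graft `(G, T) / X`: the contracted vertex is a terminal if and only
if `|X ∩ T|` is odd. -/
def contractTerminals {α : Type*} (T X : Set α) : Set (Option α) :=
  {y | (∃ x ∈ T \ X, y = some x) ∨ (y = none ∧ Odd (X ∩ T).ncard)}

/-! ### Combs and critical quasicombs -/

/-- `(G, T; A, B)` is a bipartite graft with the ordered bipartition `(A, B)`. -/
structure IsBipartiteGraft {α β : Type*} (G : Graph α β) (T A B : Set α) : Prop where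
  isGraft : IsGraft G T
  union_eq : A ∪ B = V(G)
  disjoint : Disjoint A B
  isLink : ∀ e x y, G.IsLink e x y → (x ∈ A ∧ y ∈ B) ∨ (x ∈ B ∧ y ∈ A)

/-- `(G, T; A, B)` is a comb, with spine set `A` and tooth set `B`. -/
structure IsComb {α β : Type*} (G : Graph α β) (T A B : Set α) : Prop
    extends IsBipartiteGraft G T A B where
  tooth_subset : B ⊆ T
  nu_eq : nu G T = B.encard

/-- `(G, T; A, B)` is a quasicomb, with spine set `A` and tooth set `B`. -/
structure IsQuasicomb {α β : Type*} (G : Graph α β) (T A B : Set α) : Prop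
    extends IsBipartiteGraft G T A B where
  nu_eq : nu G T = (B ∩ T).encard

/-- `(G, T; A, B)` is a critical quasicomb with root `r`. -/
structure IsCriticalQuasicomb {α β : Type*} (G : Graph α β) (T A B : Set α) (r : α) : Prop
    extends IsQuasicomb G T A B where
  root_mem : r ∈ B
  spine : ∀ x ∈ A, nu G (toggle T x r) = nu G T + 1
  tooth : ∀ x ∈ B, nu G (toggle T x r) = nu G T

/-! ### The bipartite cathedral order -/

/-- `X` is a critical set for the factor-component `G₀` of the comb `(G, T; A, B)`. -/
structure IsCriticalSet {α β : Type*} (G : Graph α β) (T A B : Set α) (G₀ : Graph α β)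
    (X : Set α) : Prop where
  separating : IsSeparating G T X
  subset : V(G₀) ⊆ X
  critical : IsCriticalQuasicomb (contract (G.induce X) V(G₀)) (contractTerminals (T ∩ X) V(G₀))
    (some '' ((A ∩ X) \ V(G₀))) (insert none (some '' ((B ∩ X) \ V(G₀)))) none

/-- `G₁ ⪯ G₂` for factor-components `G₁`, `G₂` of the comb `(G, T; A, B)`. -/
def Precedes {α β : Type*} (G : Graph α β) (T A B : Set α) (G₁ G₂ : Graph α β) : Prop :=
  ∃ X : Set α, IsCriticalSet G T A B G₁ X ∧ V(G₂) ⊆ X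

/-- The union of the vertex sets of the strict upper bounds of `G₀` in `⪯`. -/
def strictUpperVertices {α β : Type*} (G : Graph α β) (T A B : Set α) (G₀ : Graph α β) : Set α :=
  {v | ∃ H ∈ factorComponents G T, Precedes G T A B G₀ H ∧ H ≠ G₀ ∧ v ∈ V(H)}

/-! ### The general Kotzig–Lovász decomposition -/

/-- The relation `u ∼ v` on the vertices of the graft `(G, T)`. -/
def KLRel {α β : Type*} (G : Graph α β) (T : Set α) (u v : α) : Prop :=
  u = v ∨ ((∃ H ∈ factorComponents G T, u ∈ V(H) ∧ v ∈ V(H)) ∧ nu G (toggle T u v) = nu G T)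

/-- The classes of `∼` on `V(G)`. -/
def klClasses {α β : Type*} (G : Graph α β) (T : Set α) : Set (Set α) :=
  {S | ∃ u ∈ V(G), S = {v | v ∈ V(G) ∧ KLRel G T u v}}

/-- The classes of `∼` that meet the factor-component `H`. -/
def klClassesOf {α β : Type*} (G : Graph α β) (T : Set α) (H : Graph α β) : Set (Set α) :=
  {S ∈ klClasses G T | (S ∩ V(H)).Nonempty}

end Grafts

/-! Every tooth of a comb is a terminal, so a join has at least one edge at each tooth, and a
minimum join, having |B| edges, has exactly one. Up to parallel edges, minimum joins are therefore
choices of one neighbour for each tooth such that every spine vertex is chosen with a prescribed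
parity. View the teeth as hyperedges N(b) on the point set A. Such choices obey a Tutte-type theorem
(`TutteCondition.exists_isChoice`): one exists iff deleting any set S of hyperedges leaves at most
|S| odd components. A barrier is a tight S. In every choice its hyperedges choose in distinct odd
components, one in each, so no allowed edge leaves the even part of the barrier
(`IsComb.isFactorClosed_evenVertices`).

Toggling two teeth of G₀ never increases ν (`IsComb.nu_toggle_le`), and never decreases it if the
teeth are distinct and share a barrier (`IsComb.le_nu_toggle`). The neighbours of K in G₀ are teeth,
because G₀ contracts to a tooth of the critical quasicomb. So it suffices that a maximal barrier S
containing one of them, u, contains any other one, v (`IsComb.mem_of_maximal`).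

Suppose v ∉ S. The neighbour of v in K lies in a component D left by S, and D is odd. Walk in K
towards a neighbour a of u: either a ∈ D, or the walk meets a tooth b ∈ S outside G₀ with a
neighbour z ∈ D. By `TutteCondition.exists_isChoice_or_barrier`, the edge ua (or bz) is used by a
choice, or a barrier R ⊆ S containing u (or b) has an even component that includes D; then v, and
with it every tooth of G₀, lies in the even part of R. All four cases fail. The edge ua is not
allowed, since a ∉ G₀. The tooth u ∈ R is not in the even part of R. If bz is used, splicing choices
along G₀ shows that no tooth of S in G₀ ever chooses in D, so allowed edges cannot connect v to u
inside G₀. If b ∈ R, criticality yields a choice that omits b and toggles a neighbour of a tooth of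
G₀, which counting the odd components of R forbids. -/

namespace Grafts

open Finset

set_option linter.unusedSectionVars false

/-! ### Connected components of a hypergraph. -/

section Hypergraph

variable {ι κ : Type*} [DecidableEq ι] [DecidableEq κ] [Fintype κ]

/-- Every hyperedge `N i`, `i ∈ J`, lies inside `C` or misses `C`. -/
def IsClosedUnder (N : ι → Finset κ) (J : Finset ι) (C : Finset κ) : Prop :=
  ∀ i ∈ J, N i ⊆ C ∨ Disjoint (N i) C

open Classical in
/-- The connected component of `a` in the hypergraph with the hyperedges `N i`, `i ∈ J`. -/
noncomputable def component (N : ι → Finset κ) (J : Finset ι) (a : κ) : Finset κ :=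
  univ.filter fun x => ∀ C, IsClosedUnder N J C → a ∈ C → x ∈ C

variable {N : ι → Finset κ} {J J' : Finset ι} {a b : κ} {C D : Finset κ}

theorem mem_component_self : a ∈ component N J a := by
  simp [component]

theorem component_subset (hC : IsClosedUnder N J C) (ha : a ∈ C) : component N J a ⊆ C := by
  intro x hx
  simp only [component, mem_filter, mem_univ, true_and] at hx
  exact hx C hC ha

theorem isClosedUnder_component : IsClosedUnder N J (component N J a) := by
  intro i hi
  by_cases h : Disjoint (N i) (component N J a)
  · exact Or.inr h
  left
  obtain ⟨y, hy, hyc⟩ := Finset.not_disjoint_iff.1 h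
  intro x hx
  simp only [component, mem_filter, mem_univ, true_and] at hyc ⊢
  intro C hC ha
  rcases hC i hi with h1 | h1
  · exact h1 hx
  · exact absurd (hyc C hC ha) (Finset.disjoint_left.1 h1 hy)

theorem IsClosedUnder.sdiff (hC : IsClosedUnder N J C) (hD : IsClosedUnder N J D) :
    IsClosedUnder N J (C \ D) := by
  intro i hi
  rcases hC i hi with h | h
  · rcases hD i hi with h' | h'
    · right
      rw [Finset.disjoint_left]
      intro x hx hx'
      exact (mem_sdiff.1 hx').2 (h' hx)
    · left
      intro x hx
      exact mem_sdiff.2 ⟨h hx, Finset.disjoint_left.1 h' hx⟩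
  · right
    exact h.mono_right sdiff_subset

theorem IsClosedUnder.mono (hC : IsClosedUnder N J C) (h : J' ⊆ J) : IsClosedUnder N J' C :=
  fun i hi => hC i (h hi)

theorem component_eq (h : b ∈ component N J a) : component N J b = component N J a := by
  have h1 : component N J b ⊆ component N J a := component_subset isClosedUnder_component h
  refine h1.antisymm ?_
  by_cases ha : a ∈ component N J b
  · exact component_subset isClosedUnder_component ha
  -- Otherwise the difference is a closed set that contains `a` but not `b`.
  · have := component_subset (N := N) (J := J) (C := component N J a \ component N J b) (a := a)
      (isClosedUnder_component.sdiff isClosedUnder_component)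
      (mem_sdiff.2 ⟨mem_component_self, ha⟩)
    exact absurd mem_component_self (mem_sdiff.1 (this h)).2

theorem mem_component_comm : b ∈ component N J a ↔ component N J b = component N J a :=
  ⟨component_eq, fun h => h ▸ mem_component_self⟩

theorem component_mono (h : J ⊆ J') : component N J a ⊆ component N J' a :=
  component_subset (isClosedUnder_component.mono h) mem_component_self

theorem subset_component {i : ι} (hi : i ∈ J) (ha : a ∈ N i) : N i ⊆ component N J a :=
  (isClosedUnder_component i hi).resolve_right
    fun h => Finset.disjoint_left.1 h ha mem_component_self

theorem component_subset_of_local (hD : IsClosedUnder N J D) (hD' : IsClosedUnder N J' D)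
    (h : ∀ i ∈ J, N i ⊆ D → i ∈ J') (ha : a ∈ D) : component N J a ⊆ component N J' a := by
  refine component_subset (fun i hi => ?_) mem_component_self
  rcases hD i hi with h1 | h1
  · exact isClosedUnder_component i (h i hi h1)
  · exact Or.inr (h1.mono_right (component_subset hD' ha))

/-- Inside a set closed under both systems, the component only depends on the hyperedges inside
that set. -/
theorem component_congr (hD : IsClosedUnder N J D) (hD' : IsClosedUnder N J' D)
    (h : ∀ i, N i ⊆ D → (i ∈ J ↔ i ∈ J')) (ha : a ∈ D) : component N J a = component N J' a :=
  (component_subset_of_local hD hD' (fun i hi hs => (h i hs).1 hi) ha).antisymm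
    (component_subset_of_local hD' hD (fun i hi hs => (h i hs).2 hi) ha)

/-! ### Parity of components. -/

/-- The parity contributed by the point `a`: its terminal parity, and one unit for every hyperedge
of `J` represented by `a`. -/
def weight (r : ι → κ) (J : Finset ι) (τ : κ → ZMod 2) (a : κ) : ZMod 2 :=
  τ a + ((J.filter fun i => r i = a).card : ZMod 2)

/-- The components of odd parity. -/
noncomputable def oddComponents (N : ι → Finset κ) (r : ι → κ) (J : Finset ι) (τ : κ → ZMod 2) :
    Finset (Finset κ) :=
  (univ.image (component N J)).filter fun C => ∑ a ∈ C, weight r J τ a = 1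

variable {r : ι → κ} {τ τ' : κ → ZMod 2}

theorem mem_oddComponents : C ∈ oddComponents N r J τ ↔
    (∃ a, component N J a = C) ∧ ∑ a ∈ C, weight r J τ a = 1 := by
  simp [oddComponents]

theorem eq_component_of_mem (hC : C ∈ oddComponents N r J τ) (ha : a ∈ C) :
    component N J a = C := by
  obtain ⟨⟨b, rfl⟩, -⟩ := mem_oddComponents.1 hC
  exact component_eq ha

theorem sum_filter_eq_card (J : Finset ι) (f : ι → κ) (C : Finset κ) :
    ∑ a ∈ C, ((J.filter fun i => f i = a).card : ZMod 2) = (J.filter fun i => f i ∈ C).card := by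
  rw [← Nat.cast_sum]
  congr 1
  rw [Finset.card_eq_sum_card_fiberwise (s := J.filter fun i => f i ∈ C) (t := C) (f := f)]
  · refine Finset.sum_congr rfl fun a ha => ?_
    congr 1
    ext i
    simp only [mem_filter]
    constructor
    · rintro ⟨h1, rfl⟩; exact ⟨⟨h1, ha⟩, rfl⟩
    · rintro ⟨⟨h1, -⟩, h3⟩; exact ⟨h1, h3⟩
  · intro i hi
    simpa using (mem_filter.1 hi).2

/-- When `r i ∈ N i` and `C` is closed, the hyperedges represented in `C` are those lying inside
`C`. The weight of a component thus compares its terminal parity with its number of hyperedges, and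
weight 1 obstructs a choice within it. -/
theorem sum_weight (C : Finset κ) : ∑ a ∈ C, weight r J τ a =
    ∑ a ∈ C, τ a + ((J.filter fun i => r i ∈ C).card : ZMod 2) := by
  simp only [weight, Finset.sum_add_distrib]
  rw [sum_filter_eq_card]

theorem zmod_two_eq_ite (x : ZMod 2) : x = if x = 1 then 1 else 0 := by
  revert x; decide

/-- The components partition the points, so their weights add up to the total weight, and modulo 2
only the odd ones count. -/
theorem card_oddComponents :
    ((oddComponents N r J τ).card : ZMod 2) = ∑ a, τ a + (J.card : ZMod 2) := by
  have h1 : ∑ a, weight r J τ a = ∑ a, τ a + (J.card : ZMod 2) := by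
    rw [sum_weight]; simp
  rw [← h1, ← Finset.sum_fiberwise_of_maps_to (s := univ) (t := univ.image (component N J))
    (g := component N J) (fun a _ => mem_image_of_mem _ (mem_univ a)), oddComponents,
    Finset.card_filter, Nat.cast_sum]
  refine Finset.sum_congr rfl fun C hC => ?_
  obtain ⟨a, -, rfl⟩ := mem_image.1 hC
  have : (univ.filter fun x => component N J x = component N J a) = component N J a := by
    ext x; simp [mem_component_comm]
  rw [this, zmod_two_eq_ite (∑ x ∈ component N J a, weight r J τ x)]
  split_ifs <;> simp_all

/-! ### Choices, the Tutte-type condition and barriers. -/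

/-- `c` chooses a point of each hyperedge of `I`, and the number of times a point is chosen has the
parity prescribed by `τ`. -/
def IsChoice (N : ι → Finset κ) (I : Finset ι) (τ : κ → ZMod 2) (c : ι → κ) : Prop :=
  (∀ i ∈ I, c i ∈ N i) ∧ ∀ a, ((I.filter fun i => c i = a).card : ZMod 2) = τ a

variable {I S W : Finset ι} {c : ι → κ}

theorem mem_iff_rep_mem (hr : ∀ i, r i ∈ N i) (hC : IsClosedUnder N J C) {i : ι} (hi : i ∈ J)
    (ha : a ∈ N i) : a ∈ C ↔ r i ∈ C := by
  rcases hC i hi with h | h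
  · exact iff_of_true (h ha) (h (hr i))
  · exact iff_of_false (Finset.disjoint_left.1 h ha) (Finset.disjoint_left.1 h (hr i))

/-- If no hyperedge of `S` chooses in a component, its points are chosen exactly by the hyperedges
inside it, once each, so its weight is zero. This is the easy half of the Tutte-type theorem. -/
theorem oddComponents_subset_image (hr : ∀ i, r i ∈ N i) (hc : IsChoice N I τ c) :
    oddComponents N r (I \ S) τ ⊆ S.image fun i => component N (I \ S) (c i) := by
  intro C hC
  by_contra hcon
  have hclosed : IsClosedUnder N (I \ S) C := by
    obtain ⟨⟨a, rfl⟩, -⟩ := mem_oddComponents.1 hC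
    exact isClosedUnder_component
  have hno : ∀ i ∈ S, c i ∉ C := fun i hi hci =>
    hcon (mem_image.2 ⟨i, hi, eq_component_of_mem hC hci⟩)
  have h1 := (mem_oddComponents.1 hC).2
  rw [sum_weight] at h1
  have h2 : ∑ a ∈ C, τ a = ((I.filter fun i => c i ∈ C).card : ZMod 2) := by
    rw [← sum_filter_eq_card]
    exact Finset.sum_congr rfl fun a _ => (hc.2 a).symm
  have h3 : (I.filter fun i => c i ∈ C) = (I \ S).filter fun i => r i ∈ C := by
    ext i
    simp only [mem_filter, mem_sdiff]
    constructor
    · rintro ⟨hi, hci⟩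
      have hiS : i ∉ S := fun h => hno i h hci
      exact ⟨⟨hi, hiS⟩, (mem_iff_rep_mem hr hclosed (mem_sdiff.2 ⟨hi, hiS⟩) (hc.1 i hi)).1 hci⟩
    · rintro ⟨⟨hi, hiS⟩, hri⟩
      exact ⟨hi, (mem_iff_rep_mem hr hclosed (mem_sdiff.2 ⟨hi, hiS⟩) (hc.1 i hi)).2 hri⟩
  rw [h2, h3, CharTwo.add_self_eq_zero] at h1
  exact zero_ne_one h1

/-- The Tutte-type condition. -/
def TutteCondition (N : ι → Finset κ) (r : ι → κ) (I : Finset ι) (τ : κ → ZMod 2) : Prop :=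
  ∀ S ⊆ I, (oddComponents N r (I \ S) τ).card ≤ S.card

/-- The sets `S` that attain equality in the Tutte-type condition. -/
def IsBarrier (N : ι → Finset κ) (r : ι → κ) (I : Finset ι) (τ : κ → ZMod 2) (S : Finset ι) :
    Prop :=
  S ⊆ I ∧ (oddComponents N r (I \ S) τ).card = S.card

theorem IsChoice.tutteCondition (hr : ∀ i, r i ∈ N i) (hc : IsChoice N I τ c) :
    TutteCondition N r I τ := fun _ _ =>
  (card_le_card (oddComponents_subset_image hr hc)).trans card_image_le

/-- Tightness turns the inclusion into an equality: in every choice the barrier serves each odd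
component exactly once and nothing else. -/
theorem IsBarrier.image_eq (hr : ∀ i, r i ∈ N i) (hS : IsBarrier N r I τ S)
    (hc : IsChoice N I τ c) :
    oddComponents N r (I \ S) τ = S.image fun i => component N (I \ S) (c i) :=
  eq_of_subset_of_card_le (oddComponents_subset_image hr hc) (hS.2 ▸ card_image_le)

theorem IsBarrier.injOn (hr : ∀ i, r i ∈ N i) (hS : IsBarrier N r I τ S)
    (hc : IsChoice N I τ c) : Set.InjOn (fun i => component N (I \ S) (c i)) S := by
  rw [← card_image_iff, ← hS.image_eq hr hc, hS.2]

/-- The condition for the empty set forces total weight zero, and deleting `S` shifts the weight by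
|S|. Hence a set that is not a barrier has slack at least two. -/
theorem TutteCondition.card_parity (h : TutteCondition N r I τ) (hS : S ⊆ I) :
    ((oddComponents N r (I \ S) τ).card : ZMod 2) = S.card := by
  have h0 := h ∅ (empty_subset _)
  have h1 : (oddComponents N r (I \ ∅) τ).card = 0 := by simpa using h0
  have h2 := card_oddComponents (N := N) (r := r) (J := I \ ∅) (τ := τ)
  rw [h1] at h2
  rw [card_oddComponents]
  have h3 : (I.card : ZMod 2) = ((I \ S).card : ZMod 2) + S.card := by
    rw [← Nat.cast_add, card_sdiff_add_card_eq_card hS]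
  simp only [sdiff_empty, Nat.cast_zero, h3] at h2
  have h4 : ∑ a, τ a + ((I \ S).card : ZMod 2) + S.card = 0 := by rw [add_assoc]; exact h2.symm
  exact CharTwo.add_eq_zero.1 h4

theorem add_two_le_of_lt {m n : ℕ} (h : m < n) (hp : (m : ZMod 2) = n) : m + 2 ≤ n := by
  have := (ZMod.natCast_eq_natCast_iff m n 2).1 hp
  unfold Nat.ModEq at this
  omega

theorem TutteCondition.card_add_two_le (h : TutteCondition N r I τ) (hS : S ⊆ I)
    (hn : ¬ IsBarrier N r I τ S) : (oddComponents N r (I \ S) τ).card + 2 ≤ S.card :=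
  add_two_le_of_lt (lt_of_le_of_ne (h S hS) fun he => hn ⟨hS, he⟩) (h.card_parity hS)

/-- A single hyperedge has no room for slack two. So every hyperedge lies in some maximal barrier.
-/
theorem TutteCondition.isBarrier_singleton (h : TutteCondition N r I τ) {i : ι} (hi : i ∈ I) :
    IsBarrier N r I τ {i} := by
  by_contra hn
  have := h.card_add_two_le (singleton_subset_iff.2 hi) hn
  simp at this

theorem TutteCondition.exists_maximal (h : TutteCondition N r I τ) {i : ι} (hi : i ∈ I) :
    ∃ S, i ∈ S ∧ Maximal (IsBarrier N r I τ) S := by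
  have hfin : {S | IsBarrier N r I τ S}.Finite :=
    (I.powerset.finite_toSet).subset fun S hS => by simpa using hS.1
  obtain ⟨S, hle, hS⟩ := hfin.exists_le_maximal (h.isBarrier_singleton hi)
  exact ⟨S, singleton_subset_iff.1 hle, hS⟩

theorem mem_oddComponents_congr (hr : ∀ i, r i ∈ N i) (hD : IsClosedUnder N J D)
    (hD' : IsClosedUnder N J' D) (h : ∀ i, N i ⊆ D → (i ∈ J ↔ i ∈ J')) (hCD : C ⊆ D)
    (hC : C ∈ oddComponents N r J τ) : C ∈ oddComponents N r J' τ := by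
  obtain ⟨⟨a, rfl⟩, hs⟩ := mem_oddComponents.1 hC
  have ha : a ∈ D := hCD mem_component_self
  refine mem_oddComponents.2 ⟨⟨a, (component_congr hD hD' h ha).symm⟩, ?_⟩
  rw [← hs]
  refine Finset.sum_congr rfl fun x hx => ?_
  simp only [weight]
  congr 3
  ext i
  simp only [mem_filter]
  have key : ∀ {K : Finset ι}, IsClosedUnder N K D → i ∈ K → r i ∈ D → N i ⊆ D :=
    fun hK hi hri => (hK i hi).resolve_right fun hd => Finset.disjoint_left.1 hd (hr i) hri
  constructor
  · rintro ⟨hi, rfl⟩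
    exact ⟨(h i (key hD' hi (hCD hx))).2 hi, rfl⟩
  · rintro ⟨hi, rfl⟩
    exact ⟨(h i (key hD hi (hCD hx))).1 hi, rfl⟩

/-- The components in `𝒟` that are met by the hyperedge `N i`. -/
noncomputable def touched (N : ι → Finset κ) (𝒟 : Finset (Finset κ)) (i : ι) :
    Finset (Finset κ) :=
  𝒟.filter fun D => ¬ Disjoint (N i) D

/-- Odd components not met by `X` survive when `X` is put back. -/
theorem sdiff_touched_subset (hr : ∀ i, r i ∈ N i) (X : Finset ι) :
    oddComponents N r (I \ S) τ \ X.biUnion (touched N (oddComponents N r (I \ S) τ)) ⊆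
      oddComponents N r (I \ (S \ X)) τ := by
  intro D hD
  obtain ⟨hD, hDX⟩ := mem_sdiff.1 hD
  have hdisj : ∀ i ∈ X, Disjoint (N i) D := by
    intro i hi
    by_contra hn
    exact hDX (mem_biUnion.2 ⟨i, hi, mem_filter.2 ⟨hD, hn⟩⟩)
  have hcl : IsClosedUnder N (I \ S) D := by
    obtain ⟨⟨a, rfl⟩, -⟩ := mem_oddComponents.1 hD
    exact isClosedUnder_component
  have hcl' : IsClosedUnder N (I \ (S \ X)) D := by
    intro i hi
    by_cases hiX : i ∈ X
    · exact Or.inr (hdisj i hiX)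
    · refine hcl i ?_
      simp only [mem_sdiff] at hi ⊢
      tauto
  refine mem_oddComponents_congr hr hcl hcl' (fun i hi => ?_) subset_rfl hD
  have hiX : i ∉ X := fun h => Finset.disjoint_left.1 (hdisj i h) (hr i) (hi (hr i))
  simp only [mem_sdiff]
  tauto

/-! ### Sufficiency of the Tutte-type condition. -/

/-- Hall's theorem, for hyperedges choosing points in distinct members of `𝒟`. -/
theorem exists_injOn_of_hall (r : ι → κ) (X₀ : Finset ι) (𝒟 : Finset (Finset κ))
    (h𝒟 : ∀ D ∈ 𝒟, ∀ a ∈ D, component N J a = D)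
    (h : ∀ X ⊆ X₀, X.card ≤ (X.biUnion (touched N 𝒟)).card) :
    ∃ φ : ι → κ, (∀ i ∈ X₀, φ i ∈ N i ∧ component N J (φ i) ∈ 𝒟) ∧
      Set.InjOn (fun i => component N J (φ i)) X₀ := by
  have h1 : ∀ s : Finset X₀, s.card ≤ (s.biUnion fun i => touched N 𝒟 i).card := by
    intro s
    have := h (s.map (Function.Embedding.subtype _)) (by
      intro i hi
      obtain ⟨⟨j, hj⟩, -, rfl⟩ := mem_map.1 hi
      exact hj)
    rw [card_map] at this
    refine this.trans (card_le_card fun D hD => ?_)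
    obtain ⟨i, hi, hD⟩ := mem_biUnion.1 hD
    obtain ⟨j, hj, rfl⟩ := mem_map.1 hi
    exact mem_biUnion.2 ⟨j, hj, hD⟩
  obtain ⟨f, hf, hft⟩ := (Finset.all_card_le_biUnion_card_iff_exists_injective _).1 h1
  have h2 : ∀ i : X₀, ∃ a, a ∈ N i ∧ a ∈ f i := fun i =>
    Finset.not_disjoint_iff.1 (mem_filter.1 (hft i)).2
  choose g hg hgf using h2
  refine ⟨fun i => if hi : i ∈ X₀ then g ⟨i, hi⟩ else r i, fun i hi => ?_, fun i hi j hj hij => ?_⟩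
  · simp only [hi, dif_pos]
    refine ⟨hg _, ?_⟩
    have := (mem_filter.1 (hft ⟨i, hi⟩)).1
    rwa [h𝒟 _ this _ (hgf _)]
  · have hi' : i ∈ X₀ := hi
    have hj' : j ∈ X₀ := hj
    simp only [hi', hj', dif_pos] at hij
    rw [h𝒟 _ (mem_filter.1 (hft ⟨i, hi'⟩)).1 _ (hgf _),
      h𝒟 _ (mem_filter.1 (hft ⟨j, hj'⟩)).1 _ (hgf _)] at hij
    exact congrArg Subtype.val (hf hij)

/-- The terminal parities after the points `φ i`, `i ∈ S`, have been toggled. -/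
def toggleBy (τ : κ → ZMod 2) (S : Finset ι) (φ : ι → κ) (a : κ) : ZMod 2 :=
  τ a + ((S.filter fun i => φ i = a).card : ZMod 2)

theorem IsChoice.glue {φ : ι → κ} (hSI : S ⊆ I) (hφ : ∀ i ∈ S, φ i ∈ N i)
    (hc : IsChoice N (I \ S) (toggleBy τ S φ) c) :
    IsChoice N I τ fun i => if i ∈ S then φ i else c i := by
  refine ⟨fun i hi => ?_, fun a => ?_⟩
  · dsimp only
    split_ifs with h
    · exact hφ i h
    · exact hc.1 i (mem_sdiff.2 ⟨hi, h⟩)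
  · have h1 : (I.filter fun i => (if i ∈ S then φ i else c i) = a) =
        (S.filter fun i => φ i = a) ∪ ((I \ S).filter fun i => c i = a) := by
      ext i
      simp only [mem_filter, mem_union, mem_sdiff]
      by_cases h : i ∈ S
      · simp [h, hSI h]
      · simp [h]
    have hd : Disjoint (S.filter fun i => φ i = a) ((I \ S).filter fun i => c i = a) :=
      disjoint_filter_filter disjoint_sdiff
    rw [h1, card_union_of_disjoint hd, Nat.cast_add, hc.2 a, toggleBy, add_left_comm,
      CharTwo.add_self_eq_zero, add_zero]

theorem sum_weight_toggleBy (φ : ι → κ) (C : Finset κ) :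
    ∑ a ∈ C, weight r J (toggleBy τ S φ) a =
      ∑ a ∈ C, weight r J τ a + ((S.filter fun i => φ i ∈ C).card : ZMod 2) := by
  rw [← sum_filter_eq_card, ← Finset.sum_add_distrib]
  refine Finset.sum_congr rfl fun a _ => ?_
  simp only [weight, toggleBy]
  ring

/-- The odd components after toggling that are not odd before contain a toggled point. -/
theorem oddComponents_toggleBy_subset (φ : ι → κ) (D : Finset κ) :
    (oddComponents N r J (toggleBy τ S φ)).filter (· ⊆ D) ⊆
      (oddComponents N r J τ).filter (· ⊆ D) ∪
        (S.filter fun i => φ i ∈ D).image fun i => component N J (φ i) := by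
  intro C hC
  obtain ⟨hC, hCD⟩ := mem_filter.1 hC
  by_cases h : ∃ i ∈ S, φ i ∈ C
  · obtain ⟨i, hi, hiC⟩ := h
    exact mem_union_right _ (mem_image.2 ⟨i, mem_filter.2 ⟨hi, hCD hiC⟩,
      eq_component_of_mem hC hiC⟩)
  · refine mem_union_left _ (mem_filter.2 ⟨?_, hCD⟩)
    obtain ⟨h1, h2⟩ := mem_oddComponents.1 hC
    refine mem_oddComponents.2 ⟨h1, ?_⟩
    rw [sum_weight_toggleBy, filter_eq_empty_iff.2 (fun i hi hiC => h ⟨i, hi, hiC⟩)] at h2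
    simpa using h2

theorem card_oddComponents_toggleBy_le (φ : ι → κ) (D : Finset κ) :
    ((oddComponents N r J (toggleBy τ S φ)).filter (· ⊆ D)).card ≤
      ((oddComponents N r J τ).filter (· ⊆ D)).card + (S.filter fun i => φ i ∈ D).card :=
  (card_le_card (oddComponents_toggleBy_subset φ D)).trans
    ((card_union_le _ _).trans (Nat.add_le_add_left card_image_le _))

theorem mem_sdiff_filter_iff (hr : ∀ i, r i ∈ N i) :
    ∀ i, N i ⊆ D → (i ∈ J \ W ↔ i ∈ J \ W.filter fun i => r i ∈ D) := by
  intro i hi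
  simp only [mem_sdiff, mem_filter]
  have := hi (hr i)
  tauto

theorem isClosedUnder_of_mem (hC : C ∈ oddComponents N r J τ) : IsClosedUnder N J C := by
  obtain ⟨⟨a, rfl⟩, -⟩ := mem_oddComponents.1 hC
  exact isClosedUnder_component

theorem nonempty_of_mem (hC : C ∈ oddComponents N r J τ) : C.Nonempty := by
  obtain ⟨⟨a, rfl⟩, -⟩ := mem_oddComponents.1 hC
  exact ⟨a, mem_component_self⟩

theorem disjoint_of_ne (hC : ∃ x, component N J x = C) (hD : ∃ x, component N J x = D)
    (hne : C ≠ D) : Disjoint C D := by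
  obtain ⟨x, rfl⟩ := hC
  obtain ⟨y, rfl⟩ := hD
  rw [Finset.disjoint_left]
  intro z hz hz'
  exact hne ((component_eq hz).symm.trans (component_eq hz'))

/-- Removing hyperedges inside the component `D` keeps the other odd components. -/
theorem card_sdiff_add_card_filter_le (hr : ∀ i, r i ∈ N i) (hD : ∃ x, component N J x = D)
    (hW : ∀ i ∈ W, r i ∈ D) :
    (oddComponents N r J τ \ {D}).card +
      ((oddComponents N r (J \ W) τ).filter (· ⊆ D)).card ≤
      (oddComponents N r (J \ W) τ).card := by
  have hdisj : ∀ C ∈ oddComponents N r J τ \ {D}, Disjoint C D := by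
    intro C hC
    obtain ⟨hC, hCD⟩ := mem_sdiff.1 hC
    exact disjoint_of_ne (mem_oddComponents.1 hC).1 hD (by simpa using hCD)
  rw [← card_union_of_disjoint]
  · refine card_le_card (union_subset (fun C hC => ?_) (filter_subset _ _))
    have hCD := hdisj C hC
    have hC := (mem_sdiff.1 hC).1
    refine mem_oddComponents_congr hr (isClosedUnder_of_mem hC)
      ((isClosedUnder_of_mem hC).mono sdiff_subset) (fun i hi => ?_) subset_rfl hC
    have : i ∉ W := fun h => Finset.disjoint_left.1 hCD (hi (hr i)) (hW i h)
    simp [this]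
  · rw [Finset.disjoint_left]
    intro C hC hC'
    obtain ⟨x, hx⟩ := nonempty_of_mem (mem_sdiff.1 hC).1
    exact Finset.disjoint_left.1 (hdisj C hC) hx ((mem_filter.1 hC').2 hx)

theorem sum_card_filter_rep (r : ι → κ) (W : Finset ι) :
    ∑ D ∈ univ.image (component N J), (W.filter fun i => r i ∈ D).card = W.card := by
  rw [Finset.card_eq_sum_card_fiberwise (s := W) (t := univ.image (component N J))
    (f := fun i => component N J (r i)) (fun i _ => by simp)]
  refine Finset.sum_congr rfl fun D hD => ?_
  obtain ⟨a, -, rfl⟩ := mem_image.1 hD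
  simp only [mem_component_comm]

/-- A maximal barrier, together with points chosen in all its odd components, leaves a system that
still satisfies the Tutte-type condition. -/
theorem TutteCondition.sdiff_maximal (hr : ∀ i, r i ∈ N i) (h : TutteCondition N r I τ)
    (hS : Maximal (IsBarrier N r I τ) S) {φ : ι → κ}
    (hφ : ∀ i ∈ S, component N (I \ S) (φ i) ∈ oddComponents N r (I \ S) τ)
    (hinj : Set.InjOn (fun i => component N (I \ S) (φ i)) S) :
    TutteCondition N r (I \ S) (toggleBy τ S φ) := by
  intro W hW
  set J := I \ S with hJ
  have hSI := hS.prop.1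
  have hcard : (oddComponents N r J τ).card = S.card := hS.prop.2
  have himg : S.image (fun i => component N J (φ i)) = oddComponents N r J τ :=
    eq_of_subset_of_card_le (image_subset_iff.2 hφ) (by
      rw [card_image_of_injOn hinj]; exact hcard.le)
  have hcover : oddComponents N r (J \ W) (toggleBy τ S φ) ⊆ (univ.image (component N J)).biUnion
      fun D => (oddComponents N r (J \ W) (toggleBy τ S φ)).filter (· ⊆ D) := by
    intro C hC
    obtain ⟨a, rfl⟩ := (mem_oddComponents.1 hC).1
    exact mem_biUnion.2 ⟨component N J a, mem_image_of_mem _ (mem_univ a),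
      mem_filter.2 ⟨hC, component_mono sdiff_subset⟩⟩
  -- The components left by `W` refine those of `J`, so it is enough to bound them inside each
  -- component `D` of `J` by the hyperedges of `W` in `D`.
  refine ((card_le_card hcover).trans card_biUnion_le).trans ?_
  rw [← sum_card_filter_rep (N := N) (J := J) r W]
  refine Finset.sum_le_sum fun D hD => ?_
  obtain ⟨x, -, hx⟩ := mem_image.1 hD
  have hDcl : IsClosedUnder N J D := hx ▸ isClosedUnder_component
  set W' := W.filter fun i => r i ∈ D with hW'
  have hW'W : W' ⊆ W := filter_subset _ _
  have hloc : (oddComponents N r (J \ W) (toggleBy τ S φ)).filter (· ⊆ D) ⊆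
      (oddComponents N r (J \ W') (toggleBy τ S φ)).filter (· ⊆ D) := by
    intro C hC
    obtain ⟨hC, hCD⟩ := mem_filter.1 hC
    exact mem_filter.2 ⟨mem_oddComponents_congr hr (hDcl.mono sdiff_subset)
      (hDcl.mono sdiff_subset) (mem_sdiff_filter_iff hr) hCD hC, hCD⟩
  refine (card_le_card hloc).trans ?_
  have hmem : ∀ i ∈ S, φ i ∈ D → component N J (φ i) = D := by
    rintro i - hi
    rw [← hx] at hi ⊢
    exact component_eq hi
  have hA := card_oddComponents_toggleBy_le (N := N) (r := r) (J := J \ W') (τ := τ) (S := S) φ D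
  have hB := card_sdiff_add_card_filter_le (N := N) (r := r) (J := J) (W := W') (τ := τ) hr ⟨x, hx⟩
    (fun i hi => (mem_filter.1 hi).2)
  have hdisj : Disjoint S W' := by
    rw [Finset.disjoint_left]
    intro i hi hi'
    exact (mem_sdiff.1 (hW (hW'W hi'))).2 hi
  have hunion : J \ W' = I \ (S ∪ W') := by rw [hJ, sdiff_sdiff_left]; rfl
  have hsub : S ∪ W' ⊆ I := union_subset hSI ((hW'W.trans hW).trans sdiff_subset)
  by_cases hodd : D ∈ oddComponents N r J τ
  · have hone : (S.filter fun i => φ i ∈ D).card = 1 := by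
      obtain ⟨i, hi, hiD⟩ := mem_image.1 (himg ▸ hodd)
      refine card_eq_one.2 ⟨i, ?_⟩
      ext j
      simp only [mem_filter, mem_singleton]
      constructor
      · rintro ⟨hj, hjD⟩
        exact hinj hj hi ((hmem j hj hjD).trans hiD.symm)
      · rintro rfl
        exact ⟨hi, hiD ▸ mem_component_self⟩
    -- If nothing is deleted inside `D`, the only candidate is `D` itself, and its single toggled
    -- point has made it even.
    by_cases hemp : W' = ∅
    · rw [hemp, card_empty, Nat.le_zero, card_eq_zero, filter_eq_empty_iff]
      intro C hC hCD
      rw [sdiff_empty] at hC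
      obtain ⟨a, ha⟩ := nonempty_of_mem hC
      have hCD' : C = D := by
        rw [← eq_component_of_mem hC ha, eq_component_of_mem hodd (hCD ha)]
      have h1 := (mem_oddComponents.1 hC).2
      rw [sum_weight_toggleBy, hCD', hone, (mem_oddComponents.1 hodd).2] at h1
      exact absurd h1 (by decide)
    -- By maximality of `S` this set has slack two: one unit pays for `D`, which is no longer
    -- counted, the other for the toggled point in `D`.
    · have hnot : ¬ IsBarrier N r I τ (S ∪ W') := by
        intro hb
        obtain ⟨w, hw⟩ := Finset.nonempty_iff_ne_empty.2 hemp
        exact Finset.disjoint_left.1 hdisj (hS.le_of_ge hb subset_union_left (mem_union_right _ hw))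
          hw
      have h2 := h.card_add_two_le hsub hnot
      rw [card_union_of_disjoint hdisj, ← hunion] at h2
      rw [card_sdiff_of_subset (singleton_subset_iff.2 hodd), card_singleton] at hB
      have : 0 < (oddComponents N r J τ).card := card_pos.2 ⟨D, hodd⟩
      omega
  · have hzero : (S.filter fun i => φ i ∈ D).card = 0 := by
      rw [card_eq_zero, filter_eq_empty_iff]
      intro i hi hiD
      exact hodd (hmem i hi hiD ▸ hφ i hi)
    have h2 := h (S ∪ W') hsub
    rw [card_union_of_disjoint hdisj, ← hunion] at h2
    rw [sdiff_singleton_eq_erase, erase_eq_of_notMem hodd] at hB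
    omega

/-- Odd components not touched by `X` stay odd when `X` is put back, and the condition for `S \ X`
allows at most |S| - |X| of them. -/
theorem TutteCondition.hall (hr : ∀ i, r i ∈ N i) (h : TutteCondition N r I τ)
    (hS : IsBarrier N r I τ S) {X : Finset ι} (hX : X ⊆ S) :
    X.card ≤ (X.biUnion (touched N (oddComponents N r (I \ S) τ))).card := by
  have h1 := card_le_card (sdiff_touched_subset (N := N) (I := I) (S := S) (τ := τ) hr X)
  have h2 := h (S \ X) (sdiff_subset.trans hS.1)
  have h3 := le_card_sdiff (X.biUnion (touched N (oddComponents N r (I \ S) τ)))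
    (oddComponents N r (I \ S) τ)
  rw [card_sdiff_of_subset hX] at h2
  have := hS.2
  have := card_le_card hX
  omega

/-- Tutte-type theorem: the condition is sufficient for the existence of a choice. -/
theorem TutteCondition.exists_isChoice (hr : ∀ i, r i ∈ N i) :
    ∀ {I : Finset ι} {τ : κ → ZMod 2}, TutteCondition N r I τ → ∃ c, IsChoice N I τ c := by
  intro I
  induction I using Finset.strongInduction with
  | H I ih =>
    intro τ h
    rcases I.eq_empty_or_nonempty with rfl | ⟨i, hi⟩
    · refine ⟨r, by simp, fun a => ?_⟩
      -- Without hyperedges the components are single points, so the condition says that no point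
      -- has odd parity.
      have h0 := h ∅ subset_rfl
      simp only [sdiff_self, card_empty, Nat.le_zero, card_eq_zero, bot_eq_empty] at h0
      by_contra hne
      have hcl : IsClosedUnder N ∅ {a} := fun i hi => by simp at hi
      have hcomp : component N ∅ a = {a} :=
        (component_subset hcl (mem_singleton_self a)).antisymm
          (singleton_subset_iff.2 mem_component_self)
      have : ({a} : Finset κ) ∈ oddComponents N r ∅ τ := by
        refine mem_oddComponents.2 ⟨⟨a, hcomp⟩, ?_⟩
        rw [sum_singleton, weight]
        simp only [filter_empty, card_empty, Nat.cast_zero, add_zero] at hne ⊢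
        rw [zmod_two_eq_ite (τ a)] at hne ⊢
        split_ifs at hne ⊢ <;> simp_all
      rw [h0] at this
      simp at this
    -- Hall's theorem matches a maximal barrier with its odd components; the chosen points are
    -- toggled and the remaining hyperedges are handled by induction.
    · obtain ⟨S, hiS, hS⟩ := h.exists_maximal hi
      obtain ⟨φ, hφ, hinj⟩ := exists_injOn_of_hall (N := N) (J := I \ S) r S
        (oddComponents N r (I \ S) τ) (fun D hD a ha => eq_component_of_mem hD ha)
        (fun X hX => h.hall hr hS.prop hX)
      obtain ⟨c, hc⟩ := ih (I \ S) (sdiff_ssubset hS.prop.1 ⟨i, hiS⟩)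
        (h.sdiff_maximal hr hS (fun i hi => (hφ i hi).2) hinj)
      exact ⟨_, hc.glue hS.prop.1 fun i hi => (hφ i hi).1⟩

/-- For a maximal barrier `S`, a hyperedge `i ∈ S` can choose the point `z` of an odd component,
unless some barrier `R ⊆ S` containing `i` puts `z` into an even component. -/
theorem TutteCondition.exists_isChoice_or_barrier (hr : ∀ i, r i ∈ N i)
    (h : TutteCondition N r I τ) (hS : Maximal (IsBarrier N r I τ) S) {i : ι} (hi : i ∈ S) {z : κ}
    (hz : z ∈ N i) (hodd : component N (I \ S) z ∈ oddComponents N r (I \ S) τ) :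
    (∃ c, IsChoice N I τ c ∧ c i = z) ∨
      ∃ R ⊆ S, i ∈ R ∧ IsBarrier N r I τ R ∧
        component N (I \ R) z ∉ oddComponents N r (I \ R) τ := by
  set D := component N (I \ S) z with hD
  set 𝒟 := oddComponents N r (I \ S) τ with h𝒟
  -- If the other hyperedges of `S` can be matched to the odd components other than `D`, then `i` is
  -- free to take `z` in `D`.
  by_cases hall : ∀ X ⊆ S.erase i, X.card ≤ (X.biUnion (touched N (𝒟.erase D))).card
  · left
    obtain ⟨φ, hφ, hinj⟩ := exists_injOn_of_hall (N := N) (J := I \ S) r (S.erase i) (𝒟.erase D)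
      (fun C hC a ha => eq_component_of_mem (mem_of_mem_erase hC) ha) hall
    have hne : ∀ j ∈ S, j ≠ i → component N (I \ S) (φ j) ≠ D := fun j hj hji =>
      ne_of_mem_erase (hφ j (mem_erase.2 ⟨hji, hj⟩)).2
    have h1 : ∀ j ∈ S, Function.update φ i z j ∈ N j ∧
        component N (I \ S) (Function.update φ i z j) ∈ 𝒟 := by
      intro j hj
      by_cases hji : j = i
      · subst hji
        simpa using ⟨hz, hodd⟩
      · rw [Function.update_of_ne hji]
        have := hφ j (mem_erase.2 ⟨hji, hj⟩)
        exact ⟨this.1, mem_of_mem_erase this.2⟩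
    have h2 : Set.InjOn (fun j => component N (I \ S) (Function.update φ i z j)) S := by
      intro j hj k hk hjk
      by_cases hji : j = i <;> by_cases hki : k = i
      · rw [hji, hki]
      · subst hji
        simp only [Function.update_self, Function.update_of_ne hki] at hjk
        exact absurd hjk.symm (hne k hk hki)
      · subst hki
        simp only [Function.update_self, Function.update_of_ne hji] at hjk
        exact absurd hjk (hne j hj hji)
      · simp only [Function.update_of_ne hji, Function.update_of_ne hki] at hjk
        exact hinj (by simpa [hji] using hj) (by simpa [hki] using hk) hjk
    obtain ⟨c, hc⟩ := (h.sdiff_maximal hr hS (fun j hj => (h1 j hj).2) h2).exists_isChoice hr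
    exact ⟨_, hc.glue hS.prop.1 fun j hj => (h1 j hj).1, by simp [hi]⟩
  · right
    push Not at hall
    -- A Hall violator `X` gives the barrier `S \ X`: at least |S| - |X| odd components other than
    -- `D` are untouched by `X` and stay odd. By the condition they are all the odd components of `S
    -- \ X`, and none of them contains `z`.
    obtain ⟨X, hX, hlt⟩ := hall
    have hXS : X ⊆ S := hX.trans (erase_subset _ _)
    have hiX : i ∉ X := fun hi => notMem_erase i S (hX hi)
    have hRI : S \ X ⊆ I := sdiff_subset.trans hS.prop.1
    set M := insert D (X.biUnion (touched N (𝒟.erase D))) with hM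
    have hsub : 𝒟 \ M ⊆ oddComponents N r (I \ (S \ X)) τ := by
      refine Finset.Subset.trans (fun C hC => ?_)
        (sdiff_touched_subset (N := N) (I := I) (S := S) (τ := τ) hr X)
      simp only [hM, mem_sdiff, mem_insert, mem_biUnion, touched, mem_filter, mem_erase, not_or,
        not_exists, not_and] at hC ⊢
      exact ⟨hC.1, fun j hj hC' => hC.2.2 j hj ⟨hC.2.1, hC.1⟩⟩
    have hc1 := h (S \ X) hRI
    have hc2 : (S \ X).card ≤ (𝒟 \ M).card := by
      have h3 := le_card_sdiff M 𝒟
      have h4 : M.card ≤ _ + 1 := card_insert_le _ _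
      have h5 : 𝒟.card = S.card := hS.prop.2
      rw [card_sdiff_of_subset hXS]
      omega
    have heq := eq_of_subset_of_card_le hsub (hc1.trans hc2)
    refine ⟨S \ X, sdiff_subset, mem_sdiff.2 ⟨hi, hiX⟩,
      ⟨hRI, le_antisymm hc1 (hc2.trans (card_le_card hsub))⟩, fun hmem => ?_⟩
    rw [← heq] at hmem
    have hzmem : z ∈ component N (I \ (S \ X)) z := mem_component_self
    have := eq_component_of_mem (mem_sdiff.1 hmem).1 hzmem
    exact (mem_sdiff.1 hmem).2 (this ▸ mem_insert_self _ _)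

/-! ### Choices after deleting hyperedges of a barrier. -/

/-- The terminal parities after the point `a` has been toggled. -/
def toggleAt (τ : κ → ZMod 2) (a x : κ) : ZMod 2 := τ x + if x = a then 1 else 0

theorem sum_weight_toggleAt (a : κ) (C : Finset κ) :
    ∑ x ∈ C, weight r J (toggleAt τ a) x =
      ∑ x ∈ C, weight r J τ x + if a ∈ C then 1 else 0 := by
  have : ∀ x, weight r J (toggleAt τ a) x = weight r J τ x + if x = a then 1 else 0 := by
    intro x
    simp only [weight, toggleAt]
    ring
  simp only [this, Finset.sum_add_distrib, Finset.sum_ite_eq']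

theorem mem_oddComponents_toggleAt {C : Finset κ} (ha : a ∉ C) :
    C ∈ oddComponents N r J (toggleAt τ a) ↔ C ∈ oddComponents N r J τ := by
  rw [mem_oddComponents, mem_oddComponents, sum_weight_toggleAt, if_neg ha, add_zero]

/-- If the component of `a` is odd for every barrier containing `u`, then `u` can be removed and
`a` toggled. -/
theorem TutteCondition.exists_isChoice_erase (hr : ∀ i, r i ∈ N i) (h : TutteCondition N r I τ)
    {u : ι} (hu : u ∈ I) (ha : ∀ R, IsBarrier N r I τ R → u ∈ R →
      component N (I \ R) a ∈ oddComponents N r (I \ R) τ) :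
    ∃ c, IsChoice N (I.erase u) (toggleAt τ a) c := by
  refine TutteCondition.exists_isChoice (r := r) hr fun W hW => ?_
  have huW : u ∉ W := fun h => notMem_erase u I (hW h)
  have hRI : insert u W ⊆ I := insert_subset hu (hW.trans (erase_subset _ _))
  have heq : I.erase u \ W = I \ insert u W := by
    ext i; simp only [mem_sdiff, mem_erase, mem_insert]; tauto
  rw [heq]
  have hcW : (insert u W).card = W.card + 1 := card_insert_of_notMem huW
  set Ca := component N (I \ insert u W) a with hCa
  have hsub : oddComponents N r (I \ insert u W) (toggleAt τ a) ⊆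
      insert Ca (oddComponents N r (I \ insert u W) τ) := by
    intro C hC
    by_cases haC : a ∈ C
    · rw [← eq_component_of_mem hC haC]; exact mem_insert_self _ _
    · exact mem_insert_of_mem ((mem_oddComponents_toggleAt haC).1 hC)
  by_cases hb : IsBarrier N r I τ (insert u W)
  -- In the tight case the toggle turns the odd component of `a` even, which makes up for the loss
  -- of `u`. In the other case slack two absorbs both changes.
  · have hodd := ha _ hb (mem_insert_self u W)
    have hnot : Ca ∉ oddComponents N r (I \ insert u W) (toggleAt τ a) := by
      intro hC
      have h1 := (mem_oddComponents.1 hC).2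
      rw [sum_weight_toggleAt, if_pos mem_component_self, (mem_oddComponents.1 hodd).2] at h1
      exact absurd h1 (by decide)
    have hsub' : oddComponents N r (I \ insert u W) (toggleAt τ a) ⊆
        (oddComponents N r (I \ insert u W) τ).erase Ca := by
      intro C hC
      have hne : C ≠ Ca := fun h => hnot (h ▸ hC)
      exact mem_erase.2 ⟨hne, (mem_insert.1 (hsub hC)).resolve_left hne⟩
    have h1 := card_le_card hsub'
    rw [card_erase_of_mem hodd, hb.2, hcW] at h1
    simpa using h1
  · have h1 := (card_le_card hsub).trans (card_insert_le _ _)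
    have h2 := h.card_add_two_le hRI hb
    omega

/-- A choice on `I` without `u` with `a` toggled is impossible if `u` is in a barrier that has `a`
in an even component. -/
theorem IsBarrier.not_isChoice_erase (hr : ∀ i, r i ∈ N i) {R : Finset ι}
    (hR : IsBarrier N r I τ R) {u : ι} (hu : u ∈ R)
    (ha : component N (I \ R) a ∉ oddComponents N r (I \ R) τ) :
    ¬ IsChoice N (I.erase u) (toggleAt τ a) c := by
  intro hc
  have h1 := card_le_card (oddComponents_subset_image (S := R.erase u) hr hc)
  have heq : I.erase u \ R.erase u = I \ R := by
    ext i
    simp only [mem_sdiff, mem_erase]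
    have : i = u → i ∈ R := fun h => h ▸ hu
    tauto
  rw [heq] at h1
  -- The toggled point misses all odd components, so all |R| of them stay odd, with only |R| - 1
  -- hyperedges to serve them.
  have h2 : oddComponents N r (I \ R) τ ⊆ oddComponents N r (I \ R) (toggleAt τ a) := by
    intro C hC
    refine (mem_oddComponents_toggleAt fun haC => ha ?_).2 hC
    rwa [eq_component_of_mem hC haC]
  have h3 := (card_le_card h2).trans (h1.trans card_image_le)
  rw [hR.2, card_erase_of_mem hu] at h3
  have : 0 < R.card := card_pos.2 ⟨u, hu⟩
  omega

/-- No choice exists after two hyperedges of a barrier have been removed. -/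
theorem IsBarrier.not_isChoice_erase_erase (hr : ∀ i, r i ∈ N i) {R : Finset ι}
    (hR : IsBarrier N r I τ R) {u v : ι} (hu : u ∈ R) (hv : v ∈ R) :
    ¬ IsChoice N ((I.erase u).erase v) τ c := by
  intro hc
  have h1 := card_le_card (oddComponents_subset_image (S := (R.erase u).erase v) hr hc)
  have heq : (I.erase u).erase v \ (R.erase u).erase v = I \ R := by
    ext i
    simp only [mem_sdiff, mem_erase]
    have : i = u → i ∈ R := fun h => h ▸ hu
    have : i = v → i ∈ R := fun h => h ▸ hv
    tauto
  rw [heq, hR.2] at h1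
  have h2 := h1.trans card_image_le
  have h3 : ((R.erase u).erase v).card ≤ (R.erase u).card := card_erase_le
  rw [card_erase_of_mem hu] at h3
  have : 0 < R.card := card_pos.2 ⟨u, hu⟩
  omega

/-- `i` belongs to the even part of the barrier `R`. -/
def InEvenPart (N : ι → Finset κ) (r : ι → κ) (I : Finset ι) (τ : κ → ZMod 2) (R : Finset ι)
    (i : ι) : Prop :=
  i ∉ R ∧ component N (I \ R) (r i) ∉ oddComponents N r (I \ R) τ

/-- A choice respects the even part of a barrier. -/
theorem IsBarrier.inEvenPart_iff (hr : ∀ i, r i ∈ N i) {R : Finset ι}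
    (hR : IsBarrier N r I τ R) (hc : IsChoice N I τ c) {i : ι} (hi : i ∈ I) :
    InEvenPart N r I τ R i ↔ component N (I \ R) (c i) ∉ oddComponents N r (I \ R) τ := by
  by_cases hiR : i ∈ R
  · refine iff_of_false (fun h => h.1 hiR) (not_not.2 ?_)
    rw [hR.image_eq hr hc]
    exact mem_image_of_mem _ hiR
  · have : component N (I \ R) (r i) = component N (I \ R) (c i) :=
      component_eq (subset_component (mem_sdiff.2 ⟨hi, hiR⟩) (hc.1 i hi) (hr i))
    simp [InEvenPart, hiR, this]

end Hypergraph

end Grafts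

namespace Grafts

open Finset

/-! ### Edge sets of bipartite graphs as choices. -/

section Bipartite

set_option linter.unusedSectionVars false

-- Meant for the degrees of a join at the teeth: a lower bound of one on `I` and at most |I| edges
-- in all leave no freedom.
open Classical in
theorem eq_ite_of_sum_le {ι : Type*} [Fintype ι] (f : ι → ℕ) (I : Finset ι)
    (h : ∀ i ∈ I, 1 ≤ f i) (hs : ∑ i, f i ≤ I.card) (i : ι) : f i = if i ∈ I then 1 else 0 := by
  have h1 : ∀ i ∈ univ, (if i ∈ I then 1 else 0) ≤ f i := by
    intro i _
    split_ifs with hi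
    · exact h i hi
    · exact Nat.zero_le _
  have h2 : ∑ i, (if i ∈ I then 1 else 0) = ∑ i, f i := by
    refine le_antisymm (Finset.sum_le_sum h1) (hs.trans ?_)
    simp
  exact ((Finset.sum_eq_sum_iff_of_le h1).1 h2 i (mem_univ i)).symm

variable {α β : Type*} {G : Graph α β} {T A B : Set α} {p q : β → α}

/-- `p` and `q` give the ends of the edges of a bipartite graph, in `B` and in `A`. -/
structure IsOrientation (G : Graph α β) (A B : Set α) (p q : β → α) : Prop where
  disjoint : Disjoint A B
  isLink : ∀ e ∈ E(G), G.IsLink e (p e) (q e)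
  left_mem : ∀ e ∈ E(G), p e ∈ B
  right_mem : ∀ e ∈ E(G), q e ∈ A

theorem IsBipartiteGraft.exists_orientation [Nonempty α] (h : IsBipartiteGraft G T A B) :
    ∃ p q, IsOrientation G A B p q := by
  have h1 : ∀ e ∈ E(G), ∃ x y, G.IsLink e x y ∧ x ∈ B ∧ y ∈ A := by
    intro e he
    obtain ⟨x, y, hxy⟩ := Graph.exists_isLink_of_mem_edgeSet he
    rcases h.isLink e x y hxy with ⟨hx, hy⟩ | ⟨hx, hy⟩
    · exact ⟨y, x, hxy.symm, hy, hx⟩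
    · exact ⟨x, y, hxy, hx, hy⟩
  choose! p q hpq using h1
  exact ⟨p, q, h.disjoint, fun e he => (hpq e he).1, fun e he => (hpq e he).2.1,
    fun e he => (hpq e he).2.2⟩

theorem IsOrientation.eq_of_isLink (h : IsOrientation G A B p q) {e : β} {x y : α}
    (he : G.IsLink e x y) (hx : x ∈ B) : p e = x ∧ q e = y := by
  rcases (h.isLink e he.edge_mem).eq_and_eq_or_eq_and_eq he with h1 | ⟨-, h2⟩
  · exact h1
  · exact absurd hx (h2 ▸ Set.disjoint_left.1 h.disjoint (h.right_mem e he.edge_mem))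

theorem IsOrientation.cut_tooth (h : IsOrientation G A B p q) {F : Set β} (hF : F ⊆ E(G)) {b : α}
    (hb : b ∈ B) : cut G {b} ∩ F = {e ∈ F | p e = b} := by
  ext e
  constructor
  · rintro ⟨⟨x, y, hxy, rfl, -⟩, he⟩
    exact ⟨he, (h.eq_of_isLink hxy hb).1⟩
  · rintro ⟨he, rfl⟩
    refine ⟨⟨p e, q e, h.isLink e (hF he), rfl, fun hq => ?_⟩, he⟩
    exact Set.disjoint_left.1 h.disjoint (h.right_mem e (hF he)) (Set.mem_singleton_iff.1 hq ▸ hb)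

theorem IsOrientation.cut_spine (h : IsOrientation G A B p q) {F : Set β} (hF : F ⊆ E(G)) {a : α}
    (ha : a ∈ A) : cut G {a} ∩ F = {e ∈ F | q e = a} := by
  ext e
  constructor
  · rintro ⟨⟨x, y, hxy, rfl, -⟩, he⟩
    refine ⟨he, ?_⟩
    rcases (h.isLink e hxy.edge_mem).eq_and_eq_or_eq_and_eq hxy with ⟨h1, -⟩ | ⟨-, h2⟩
    · exact absurd (h1 ▸ h.left_mem e hxy.edge_mem) (Set.disjoint_left.1 h.disjoint ha)
    · exact h2
  · rintro ⟨he, rfl⟩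
    refine ⟨⟨q e, p e, (h.isLink e (hF he)).symm, rfl, fun hq => ?_⟩, he⟩
    exact Set.disjoint_left.1 h.disjoint ha (Set.mem_singleton_iff.1 hq ▸ h.left_mem e (hF he))

open Classical in
theorem IsOrientation.isJoin_iff (h : IsOrientation G A B p q) (hV : A ∪ B = V(G)) {F : Finset β} :
    IsJoin G T F ↔ (F : Set β) ⊆ E(G) ∧
      (∀ b ∈ B, Odd (F.filter fun e => p e = b).card ↔ b ∈ T) ∧
      ∀ a ∈ A, Odd (F.filter fun e => q e = a).card ↔ a ∈ T := by
  refine and_congr_right fun hF => ?_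
  have h1 : ∀ b ∈ B, (cut G {b} ∩ ↑F).ncard = (F.filter fun e => p e = b).card := by
    intro b hb
    rw [h.cut_tooth hF hb, ← Set.ncard_coe_finset]
    simp
  have h2 : ∀ a ∈ A, (cut G {a} ∩ ↑F).ncard = (F.filter fun e => q e = a).card := by
    intro a ha
    rw [h.cut_spine hF ha, ← Set.ncard_coe_finset]
    simp
  rw [← hV]
  constructor
  · intro hv
    exact ⟨fun b hb => h1 b hb ▸ hv b (Or.inr hb), fun a ha => h2 a ha ▸ hv a (Or.inl ha)⟩
  · rintro ⟨hB, hA⟩ v (hv | hv)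
    · rw [h2 v hv]; exact hA v hv
    · rw [h1 v hv]; exact hB v hv

theorem nu_le {F : Set β} (hF : IsJoin G T F) : nu G T ≤ F.encard := iInf₂_le F hF

theorem exists_isJoin_of_nu_le {n : ℕ} (h : nu G T ≤ n) :
    ∃ F : Finset β, IsJoin G T F ∧ F.card ≤ n := by
  have h1 : nu G T < (n : ℕ∞) + 1 := lt_of_le_of_lt h (by exact_mod_cast Nat.lt_succ_self n)
  simp only [nu, iInf_lt_iff] at h1
  obtain ⟨F, hF, hlt⟩ := h1
  have hle : F.encard ≤ n := Order.le_of_lt_add_one hlt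
  have hfin : F.Finite := Set.finite_of_encard_le_coe hle
  lift F to Finset β using hfin
  exact ⟨F, hF, by simpa using hle⟩

variable [Fintype A] [Fintype B]

open Classical in
/-- The neighbours of a tooth in the spine set. -/
noncomputable def toothNbrs (G : Graph α β) (A B : Set α) [Fintype A] (b : B) : Finset A :=
  univ.filter fun a => G.Adj b a

theorem mem_toothNbrs {b : B} {a : A} : a ∈ toothNbrs G A B b ↔ G.Adj b a := by
  simp [toothNbrs]

open Classical in
/-- The terminal parities on the spine set. -/
noncomputable def spineParity (T A : Set α) (a : A) : ZMod 2 := if (a : α) ∈ T then 1 else 0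

open Classical in
theorem IsOrientation.sum_card_tooth (h : IsOrientation G A B p q) {F : Finset β}
    (hF : (F : Set β) ⊆ E(G)) :
    ∑ b : B, (F.filter fun e => p e = b).card = F.card := by
  rw [Finset.card_eq_sum_card_fiberwise (s := F) (t := B.toFinset) (f := p)
    (fun e he => by simpa using h.left_mem e (hF he))]
  exact (Finset.sum_subtype B.toFinset (fun x => by simp)
    (fun b => (F.filter fun e => p e = b).card)).symm

open Classical in
/-- An edge set with at most one edge at each tooth is a choice of neighbours. -/
theorem IsOrientation.exists_isChoice (h : IsOrientation G A B p q) (r : B → A) {F : Finset β}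
    (hF : (F : Set β) ⊆ E(G)) {I : Finset B}
    (hdeg : ∀ b : B, (F.filter fun e => p e = b).card = if b ∈ I then 1 else 0) :
    ∃ c : B → A, IsChoice (toothNbrs G A B) I
      (fun a => ((F.filter fun e => q e = a).card : ZMod 2)) c ∧
      ∀ e ∈ F, ∀ b : B, p e = b → (c b : α) = q e := by
  have h1 : ∀ b ∈ I, ∃ e ∈ F, p e = b ∧ ∀ e' ∈ F, p e' = b → e' = e := by
    intro b hb
    have := hdeg b
    rw [if_pos hb, card_eq_one] at this
    obtain ⟨e, he⟩ := this
    have he1 : e ∈ F.filter fun e => p e = b := he ▸ mem_singleton_self e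
    exact ⟨e, (mem_filter.1 he1).1, (mem_filter.1 he1).2, fun e' he' hp =>
      mem_singleton.1 (he ▸ mem_filter.2 ⟨he', hp⟩)⟩
  have hI : ∀ e ∈ F, ∀ b : B, p e = b → b ∈ I := by
    intro e he b hb
    by_contra hbI
    have := hdeg b
    rw [if_neg hbI, card_eq_zero, filter_eq_empty_iff] at this
    exact this he hb
  have hc : ∀ b : B, ∃ a : A, b ∈ I →
      ∃ e ∈ F, p e = b ∧ q e = a ∧ ∀ e' ∈ F, p e' = b → e' = e := by
    intro b
    by_cases hb : b ∈ I
    · obtain ⟨e, he, hp, hu⟩ := h1 b hb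
      exact ⟨⟨q e, h.right_mem _ (hF he)⟩, fun _ => ⟨e, he, hp, rfl, hu⟩⟩
    · exact ⟨r b, fun hb' => absurd hb' hb⟩
  choose c hc using hc
  have hce : ∀ e ∈ F, ∀ b : B, p e = b → (c b : α) = q e := by
    intro e he b hb
    obtain ⟨e', -, -, hq, hu⟩ := hc b (hI e he b hb)
    rw [hu e he hb, hq]
  refine ⟨c, ⟨fun b hb => ?_, fun a => ?_⟩, hce⟩
  · obtain ⟨e, he, hp, hq, -⟩ := hc b hb
    exact mem_toothNbrs.2 ⟨e, hp ▸ hq ▸ h.isLink e (hF he)⟩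
  · congr 1
    symm
    refine card_bij (fun e he => ⟨p e, h.left_mem e (hF (mem_filter.1 he).1)⟩) ?_ ?_ ?_
    · intro e he
      obtain ⟨he, hq⟩ := mem_filter.1 he
      exact mem_filter.2 ⟨hI e he _ rfl, Subtype.ext ((hce e he _ rfl).trans hq)⟩
    · intro e he e' he' heq
      have heq : p e = p e' := congrArg Subtype.val heq
      have he := (mem_filter.1 he).1
      have he' := (mem_filter.1 he').1
      obtain ⟨e₀, -, -, -, hu⟩ := hc ⟨p e, h.left_mem e (hF he)⟩ (hI e he _ rfl)
      rw [hu e he rfl, hu e' he' heq.symm]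
    · intro b hb
      obtain ⟨hb, hcb⟩ := mem_filter.1 hb
      obtain ⟨e, he, hp, hq, -⟩ := hc b hb
      exact ⟨e, mem_filter.2 ⟨he, hq.trans (congrArg Subtype.val hcb)⟩, Subtype.ext hp⟩

open Classical in
/-- A choice of neighbours is realized by an edge set. -/
theorem IsOrientation.exists_edges (h : IsOrientation G A B p q) {I : Finset B} {τ : A → ZMod 2}
    {c : B → A} (hc : IsChoice (toothNbrs G A B) I τ c) :
    ∃ F : Finset β, (F : Set β) ⊆ E(G) ∧ F.card = I.card ∧
      (∀ b : B, (F.filter fun e => p e = b).card = if b ∈ I then 1 else 0) ∧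
      (∀ a : A, ((F.filter fun e => q e = a).card : ZMod 2) = τ a) ∧
      ∀ b ∈ I, ∃ e ∈ F, G.IsLink e b (c b) := by
  have h1 : ∀ b : I, ∃ e, G.IsLink e b.1 (c b.1) := fun b => mem_toothNbrs.1 (hc.1 b.1 b.2)
  choose s hs using h1
  have hp : ∀ b, p (s b) = b.1 := fun b => (h.eq_of_isLink (hs b) b.1.2).1
  have hq : ∀ b, q (s b) = c b.1 := fun b => (h.eq_of_isLink (hs b) b.1.2).2
  have hinj : Function.Injective s := fun b b' heq =>
    Subtype.ext (Subtype.ext ((hp b).symm.trans ((congrArg p heq).trans (hp b'))))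
  refine ⟨univ.image s, ?_, ?_, fun b => ?_, fun a => ?_, fun b hb => ?_⟩
  · intro e he
    obtain ⟨b, -, rfl⟩ := mem_image.1 (mem_coe.1 he)
    exact (hs b).edge_mem
  · rw [card_image_of_injective _ hinj]; simp
  · split_ifs with hb
    · refine card_eq_one.2 ⟨s ⟨b, hb⟩, ?_⟩
      ext e
      simp only [mem_filter, mem_image, mem_univ, true_and, mem_singleton]
      constructor
      · rintro ⟨⟨b', rfl⟩, hb'⟩
        rw [hp] at hb'
        congr 1
        exact Subtype.ext (Subtype.ext hb')
      · rintro rfl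
        exact ⟨⟨_, rfl⟩, hp _⟩
    · rw [card_eq_zero, filter_eq_empty_iff]
      intro e he heb
      obtain ⟨b', -, rfl⟩ := mem_image.1 he
      rw [hp] at heb
      exact hb (Subtype.ext heb ▸ b'.2)
  · rw [← hc.2 a]
    congr 1
    symm
    refine card_bij (fun b hb => s ⟨b, (mem_filter.1 hb).1⟩) ?_ ?_ ?_
    · intro b hb
      exact mem_filter.2 ⟨mem_image_of_mem _ (mem_univ _),
        (hq _).trans (congrArg Subtype.val (mem_filter.1 hb).2)⟩
    · intro b hb b' hb' heq
      exact congrArg Subtype.val (hinj heq)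
    · intro e he
      obtain ⟨he, hea⟩ := mem_filter.1 he
      obtain ⟨b, -, rfl⟩ := mem_image.1 he
      rw [hq] at hea
      exact ⟨b.1, mem_filter.2 ⟨b.2, Subtype.ext hea⟩, rfl⟩
  · exact ⟨s ⟨b, hb⟩, mem_image_of_mem _ (mem_univ _), hs _⟩

theorem odd_iff_of_cast_eq {n : ℕ} {P : Prop} [Decidable P]
    (h : (n : ZMod 2) = if P then 1 else 0) : Odd n ↔ P := by
  rw [← ZMod.natCast_eq_one_iff_odd, h]
  split_ifs with hP <;> simp [hP]

theorem cast_eq_of_odd_iff {n : ℕ} {P : Prop} [Decidable P] (h : Odd n ↔ P) :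
    (n : ZMod 2) = if P then 1 else 0 := by
  rw [← ZMod.natCast_eq_one_iff_odd] at h
  rw [zmod_two_eq_ite (n : ZMod 2)]
  simp only [h]

/-! ### Minimum joins of a comb -/

theorem IsComb.isMinJoin_iff (h : IsComb G T A B) {F : Set β} :
    IsMinJoin G T F ↔ IsJoin G T F ∧ F.encard ≤ (Fintype.card B : ℕ) := by
  have hB : B.encard = (Fintype.card B : ℕ) := by
    rw [← Set.coe_fintypeCard]
  have hnu : nu G T = (Fintype.card B : ℕ) := h.nu_eq.trans hB
  constructor
  · rintro ⟨hF, hmin⟩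
    obtain ⟨F', hF', hle⟩ := exists_isJoin_of_nu_le hnu.le
    refine ⟨hF, (hmin F' hF').trans ?_⟩
    rw [Set.encard_coe_eq_coe_finsetCard]
    exact_mod_cast hle
  · rintro ⟨hF, hle⟩
    exact ⟨hF, fun F' hF' => hle.trans (hnu ▸ nu_le hF')⟩

open Classical in
/-- The choices of neighbours that correspond to the minimum joins of a comb. -/
def IsCombChoice (G : Graph α β) (T A B : Set α) [Fintype A] [Fintype B] (c : B → A) : Prop :=
  IsChoice (toothNbrs G A B) univ (spineParity T A) c

theorem spineParity_eq_of_isJoin (h : IsOrientation G A B p q) (hV : A ∪ B = V(G)) {F : Finset β}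
    (hF : IsJoin G T F) (a : A) [DecidablePred fun e => q e = a] :
    ((F.filter fun e => q e = a).card : ZMod 2) = spineParity T A a := by
  classical
  have := ((h.isJoin_iff hV).1 hF).2.2 a a.2
  rw [spineParity]
  convert cast_eq_of_odd_iff this

/-- Teeth are terminals and so have odd, hence positive, degree in a join; |B| edges leave exactly
one for each. -/
theorem IsComb.exists_choice (h : IsComb G T A B) (hpq : IsOrientation G A B p q) {F : Finset β}
    (hF : IsMinJoin G T F) (r : B → A) : ∃ c : B → A, IsCombChoice G T A B c ∧
      (∀ e ∈ F, ∀ b : B, p e = b → (c b : α) = q e) ∧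
      ∀ b : B, ∃ e ∈ F, p e = b ∧ q e = c b := by
  classical
  obtain ⟨hJ, hle⟩ := h.isMinJoin_iff.1 hF
  rw [Set.encard_coe_eq_coe_finsetCard] at hle
  have hle : F.card ≤ Fintype.card B := by exact_mod_cast hle
  obtain ⟨hFE, hodd, -⟩ := (hpq.isJoin_iff h.union_eq).1 hJ
  have hdeg := eq_ite_of_sum_le (fun b : B => (F.filter fun e => p e = b).card) univ
    (fun b _ => ((hodd b b.2).2 (h.tooth_subset b.2)).pos)
    ((hpq.sum_card_tooth hFE).trans_le hle)
  obtain ⟨c, hc, hce⟩ := hpq.exists_isChoice r hFE (I := univ) (fun b => by convert hdeg b)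
  refine ⟨c, ⟨hc.1, fun a => (hc.2 a).trans ?_⟩, hce, fun b => ?_⟩
  · exact spineParity_eq_of_isJoin hpq h.union_eq hJ a
  · have := hdeg b
    simp only [mem_univ, if_true, card_eq_one] at this
    obtain ⟨e, he⟩ := this
    have he1 : e ∈ F.filter fun e => p e = b := he ▸ mem_singleton_self e
    exact ⟨e, (mem_filter.1 he1).1, (mem_filter.1 he1).2,
      (hce e (mem_filter.1 he1).1 b (mem_filter.1 he1).2).symm⟩

theorem IsComb.exists_choice_of_mem_allowedEdges (h : IsComb G T A B)
    (hpq : IsOrientation G A B p q) (hE : E(G).Finite) (r : B → A) {e : β}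
    (he : e ∈ allowedEdges G T) :
    ∃ c : B → A, IsCombChoice G T A B c ∧ ∃ b : B, G.IsLink e b (c b) := by
  obtain ⟨F, hF, heF⟩ := he
  have hfin : F.Finite := hE.subset hF.1.1
  lift F to Finset β using hfin
  obtain ⟨c, hc, hce, -⟩ := h.exists_choice hpq hF r
  have heE : e ∈ E(G) := hF.1.1 heF
  refine ⟨c, hc, ⟨p e, hpq.left_mem e heE⟩, ?_⟩
  rw [hce e heF _ rfl]
  exact hpq.isLink e heE

theorem IsComb.exists_allowed_of_choice (h : IsComb G T A B) (hpq : IsOrientation G A B p q)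
    {c : B → A} (hc : IsCombChoice G T A B c) :
    ∃ F : Finset β, IsMinJoin G T F ∧ ∀ b : B, ∃ e ∈ F, G.IsLink e b (c b) := by
  classical
  obtain ⟨F, hFE, hcard, hdegp, hdegq, hlink⟩ := hpq.exists_edges hc
  refine ⟨F, h.isMinJoin_iff.2 ⟨(hpq.isJoin_iff h.union_eq).2
    ⟨hFE, fun b hb => ?_, fun a ha => ?_⟩, ?_⟩, fun b => hlink b (mem_univ b)⟩
  · have := hdegp ⟨b, hb⟩
    simp only [mem_univ, if_true] at this
    rw [this]
    exact iff_of_true odd_one (h.tooth_subset hb)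
  · exact odd_iff_of_cast_eq (hdegq ⟨a, ha⟩)
  · rw [Set.encard_coe_eq_coe_finsetCard, hcard, card_univ]

theorem IsComb.exists_isCombChoice (h : IsComb G T A B) (hpq : IsOrientation G A B p q)
    (r : B → A) : ∃ c, IsCombChoice G T A B c := by
  have hnu : nu G T ≤ (Fintype.card B : ℕ) := by
    rw [h.nu_eq, ← Set.coe_fintypeCard]
  obtain ⟨F, hF, hle⟩ := exists_isJoin_of_nu_le hnu
  have hmin : IsMinJoin G T F := h.isMinJoin_iff.2 ⟨hF, by
    rw [Set.encard_coe_eq_coe_finsetCard]; exact_mod_cast hle⟩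
  obtain ⟨c, hc, -⟩ := h.exists_choice hpq hmin r
  exact ⟨c, hc⟩

/-- A tooth of a comb has a neighbour. -/
theorem IsComb.exists_nbr (h : IsComb G T A B) (hpq : IsOrientation G A B p q) :
    ∃ r : B → A, ∀ b, r b ∈ toothNbrs G A B b := by
  classical
  have hnu : nu G T ≤ (Fintype.card B : ℕ) := by
    rw [h.nu_eq, ← Set.coe_fintypeCard]
  obtain ⟨F, hF, -⟩ := exists_isJoin_of_nu_le hnu
  obtain ⟨hFE, hodd, -⟩ := (hpq.isJoin_iff h.union_eq).1 hF
  have : ∀ b : B, ∃ a, a ∈ toothNbrs G A B b := by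
    intro b
    obtain ⟨e, he⟩ := card_pos.1 ((hodd b b.2).2 (h.tooth_subset b.2)).pos
    obtain ⟨he, hp⟩ := mem_filter.1 he
    exact ⟨⟨q e, hpq.right_mem e (hFE he)⟩, mem_toothNbrs.2 ⟨e, hp ▸ hpq.isLink e (hFE he)⟩⟩
  choose r hr using this
  exact ⟨r, hr⟩

end Bipartite

end Grafts

namespace Grafts

open Finset

/-! ### Sets that no allowed edge leaves. -/

section FactorClosed

variable {α β : Type*} {G H H' : Graph α β} {T Y Z : Set α} {x y : α}

theorem FactorConnected.symm (h : FactorConnected G T x y) : FactorConnected G T y x := by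
  obtain ⟨hx, h⟩ := h
  refine ⟨?_, ?_⟩
  · rcases Relation.ReflTransGen.cases_tail h with rfl | ⟨z, -, hz⟩
    · exact hx
    · exact hz.right_mem
  · induction h with
    | refl => exact .refl
    | tail _ hz ih => exact .head hz.symm ih

theorem FactorConnected.trans {z : α} (h : FactorConnected G T x y) (h' : FactorConnected G T y z) :
    FactorConnected G T x z := ⟨h.1, h.2.trans h'.2⟩

theorem factorConnected_of_mem (hH : H ∈ factorComponents G T) (hx : x ∈ V(H)) (hy : y ∈ V(H)) :
    FactorConnected G T x y := by
  obtain ⟨v, -, rfl⟩ := hH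
  exact FactorConnected.symm hx |>.trans hy

theorem mem_of_factorConnected (hH : H ∈ factorComponents G T) (hx : x ∈ V(H))
    (h : FactorConnected G T x y) : y ∈ V(H) := by
  obtain ⟨v, -, rfl⟩ := hH
  exact FactorConnected.trans hx h

theorem mem_vertexSet_of_mem (hH : H ∈ factorComponents G T) (hx : x ∈ V(H)) : x ∈ V(G) :=
  (factorConnected_of_mem hH hx hx).1

theorem factorComponents_eq_of_mem (hH : H ∈ factorComponents G T)
    (hH' : H' ∈ factorComponents G T) (hx : x ∈ V(H)) (hx' : x ∈ V(H')) : H = H' := by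
  have hVV : V(H) = V(H') := by
    ext z
    exact ⟨fun hz => mem_of_factorConnected hH' hx' (factorConnected_of_mem hH hx hz),
      fun hz => mem_of_factorConnected hH hx (factorConnected_of_mem hH' hx' hz)⟩
  obtain ⟨v, -, rfl⟩ := hH
  obtain ⟨w, -, rfl⟩ := hH'
  have : {u | FactorConnected G T v u} = {u | FactorConnected G T w u} := hVV
  rw [this]

/-- No allowed edge leaves `Y`. -/
def IsFactorClosed (G : Graph α β) (T Y : Set α) : Prop :=
  ∀ e ∈ allowedEdges G T, ∀ x y, G.IsLink e x y → x ∈ Y → y ∈ Y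

theorem IsFactorClosed.mem_iff (hY : IsFactorClosed G T Y) {e : β} (he : e ∈ allowedEdges G T)
    (hl : G.IsLink e x y) : x ∈ Y ↔ y ∈ Y :=
  ⟨hY e he x y hl, hY e he y x hl.symm⟩

theorem IsFactorClosed.mem_of_factorConnected (hY : IsFactorClosed G T Y)
    (h : FactorConnected G T x y) (hx : x ∈ Y) : y ∈ Y := by
  obtain ⟨-, h⟩ := h
  induction h with
  | refl => exact hx
  | tail _ hz ih =>
    obtain ⟨e, he⟩ := hz
    exact hY e he.1 _ _ he.2 ih

theorem IsFactorClosed.sdiff (hY : IsFactorClosed G T Y) (hZ : IsFactorClosed G T Z) :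
    IsFactorClosed G T (Y \ Z) := fun _ he _ _ hl hx =>
  ⟨(hY.mem_iff he hl).1 hx.1, fun hz => hx.2 ((hZ.mem_iff he hl).2 hz)⟩

theorem isFactorClosed_vertexSet (hH : H ∈ factorComponents G T) : IsFactorClosed G T V(H) :=
  fun e he _ _ hl hx => mem_of_factorConnected hH hx
    ⟨mem_vertexSet_of_mem hH hx, .single ⟨e, he, hl⟩⟩

theorem IsSeparating.isFactorClosed (hY : IsSeparating G T Y) : IsFactorClosed G T Y := by
  obtain ⟨𝓗, h𝓗, rfl⟩ := hY
  intro e he x y hl hx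
  simp only [Set.mem_iUnion] at hx ⊢
  obtain ⟨H, hH, hx⟩ := hx
  exact ⟨H, hH, isFactorClosed_vertexSet (h𝓗 hH) e he x y hl hx⟩

theorem IsSeparating.subset (hY : IsSeparating G T Y) : Y ⊆ V(G) := by
  obtain ⟨𝓗, h𝓗, rfl⟩ := hY
  intro x hx
  simp only [Set.mem_iUnion] at hx
  obtain ⟨H, hH, hx⟩ := hx
  exact mem_vertexSet_of_mem (h𝓗 hH) hx

end FactorClosed

/-! ### Even parts of barriers, and ν after toggling two teeth. -/

section Comb

variable {α β : Type*} {G G₀ : Graph α β} {T A B X Y : Set α} {p q : β → α} [Fintype A] [Fintype B]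
  {r : B → A}

theorem IsComb.mem_iff_of_choice (h : IsComb G T A B) (hpq : IsOrientation G A B p q)
    (hY : IsFactorClosed G T Y) {c : B → A} (hc : IsCombChoice G T A B c) (b : B) :
    (b : α) ∈ Y ↔ (c b : α) ∈ Y := by
  obtain ⟨F, hF, hl⟩ := h.exists_allowed_of_choice hpq hc
  obtain ⟨e, he, hl⟩ := hl b
  exact hY.mem_iff ⟨F, hF, he⟩ hl

/-- Every allowed edge joins some tooth `b` to `c b` for some choice `c`, so closure can be tested
on choices. -/
theorem IsComb.isFactorClosed_of_choice (h : IsComb G T A B) (hpq : IsOrientation G A B p q)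
    (hE : E(G).Finite) (r : B → A)
    (hY : ∀ c : B → A, IsCombChoice G T A B c → ∀ b : B, ((b : α) ∈ Y ↔ (c b : α) ∈ Y)) :
    IsFactorClosed G T Y := by
  intro e he x y hl hx
  obtain ⟨c, hc, b, hb⟩ := h.exists_choice_of_mem_allowedEdges hpq hE r he
  rcases hl.eq_and_eq_or_eq_and_eq hb with ⟨rfl, rfl⟩ | ⟨rfl, rfl⟩
  · exact (hY c hc b).1 hx
  · exact (hY c hc b).2 hx

open Classical in
/-- The vertices in the even part of a barrier. -/
def evenVertices (G : Graph α β) (T A B : Set α) [Fintype A] [Fintype B] (r : B → A)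
    (R : Finset B) : Set α :=
  {x | (∃ a : A, (a : α) = x ∧ component (toothNbrs G A B) (univ \ R) a ∉
      oddComponents (toothNbrs G A B) r (univ \ R) (spineParity T A)) ∨
    ∃ b : B, (b : α) = x ∧ InEvenPart (toothNbrs G A B) r univ (spineParity T A) R b}

open Classical in
theorem spine_mem_evenVertices (hd : Disjoint A B) {R : Finset B} (a : A) :
    (a : α) ∈ evenVertices G T A B r R ↔ component (toothNbrs G A B) (univ \ R) a ∉
      oddComponents (toothNbrs G A B) r (univ \ R) (spineParity T A) := by
  constructor
  · rintro (⟨a', ha, h⟩ | ⟨b, hb, -⟩)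
    · rwa [← Subtype.ext ha]
    · exact absurd (hb ▸ b.2) (Set.disjoint_left.1 hd a.2)
  · exact fun h => Or.inl ⟨a, rfl, h⟩

open Classical in
theorem tooth_mem_evenVertices (hd : Disjoint A B) {R : Finset B} (b : B) :
    (b : α) ∈ evenVertices G T A B r R ↔
      InEvenPart (toothNbrs G A B) r univ (spineParity T A) R b := by
  constructor
  · rintro (⟨a, ha, -⟩ | ⟨b', hb, h⟩)
    · exact absurd b.2 (Set.disjoint_left.1 hd (ha ▸ a.2))
    · rwa [← Subtype.ext hb]
  · exact fun h => Or.inr ⟨b, rfl, h⟩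

-- In any choice, barrier teeth choose in odd components and every other tooth stays in its own
-- component. Consequently a factor-component that meets `R` misses the even part of `R`.
open Classical in
theorem IsComb.isFactorClosed_evenVertices (h : IsComb G T A B) (hpq : IsOrientation G A B p q)
    (hE : E(G).Finite) (hr : ∀ b, r b ∈ toothNbrs G A B b) {R : Finset B}
    (hR : IsBarrier (toothNbrs G A B) r univ (spineParity T A) R) :
    IsFactorClosed G T (evenVertices G T A B r R) := by
  refine h.isFactorClosed_of_choice hpq hE r fun c hc b => ?_
  rw [tooth_mem_evenVertices h.disjoint, spine_mem_evenVertices h.disjoint]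
  exact hR.inEvenPart_iff hr hc (mem_univ b)

theorem IsComb.card_tooth_eq_one (h : IsComb G T A B) (hpq : IsOrientation G A B p q)
    {F : Finset β} (hF : IsMinJoin G T F) (b : B) [DecidablePred fun e => p e = b] :
    (F.filter fun e => p e = b).card = 1 := by
  classical
  obtain ⟨hJ, hle⟩ := h.isMinJoin_iff.1 hF
  rw [Set.encard_coe_eq_coe_finsetCard] at hle
  have hle : F.card ≤ Fintype.card B := by exact_mod_cast hle
  obtain ⟨hFE, hodd, -⟩ := (hpq.isJoin_iff h.union_eq).1 hJ
  have hdeg := eq_ite_of_sum_le (fun b : B => (F.filter fun e => p e = b).card) univ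
    (fun b _ => ((hodd b b.2).2 (h.tooth_subset b.2)).pos)
    ((hpq.sum_card_tooth hFE).trans_le hle) b
  simp only [mem_univ, if_true] at hdeg
  convert hdeg

/-- A factor-closed set contains an even number of terminals. -/
theorem IsComb.even_ncard_inter (h : IsComb G T A B) (hpq : IsOrientation G A B p q)
    {c : B → A} (hc : IsCombChoice G T A B c) (hY : IsFactorClosed G T Y) (hYV : Y ⊆ V(G)) :
    Even (Y ∩ T).ncard := by
  classical
  have h1 : Y ∩ T = Subtype.val '' (↑(univ.filter fun b : B => (b : α) ∈ Y) : Set B) ∪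
      Subtype.val '' (↑(univ.filter fun a : A => (a : α) ∈ Y ∧ (a : α) ∈ T) : Set A) := by
    ext x
    simp only [Set.mem_inter_iff, Set.mem_union, Set.mem_image, coe_filter, mem_univ, true_and,
      Set.mem_ofPred_eq]
    constructor
    · rintro ⟨hx, hxT⟩
      rcases (h.union_eq.symm ▸ hYV hx : x ∈ A ∪ B) with hA | hB
      · exact Or.inr ⟨⟨x, hA⟩, ⟨hx, hxT⟩, rfl⟩
      · exact Or.inl ⟨⟨x, hB⟩, hx, rfl⟩
    · rintro (⟨b, hb, rfl⟩ | ⟨a, ha, rfl⟩)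
      · exact ⟨hb, h.tooth_subset b.2⟩
      · exact ha
  have hd : Disjoint (Subtype.val '' (↑(univ.filter fun b : B => (b : α) ∈ Y) : Set B))
      (Subtype.val '' (↑(univ.filter fun a : A => (a : α) ∈ Y ∧ (a : α) ∈ T) : Set A)) := by
    rw [Set.disjoint_left]
    rintro x ⟨b, -, rfl⟩ ⟨a, -, ha⟩
    exact Set.disjoint_left.1 h.disjoint a.2 (ha ▸ b.2)
  rw [h1, Set.ncard_union_eq hd (Set.toFinite _) (Set.toFinite _),
    Set.ncard_image_of_injective _ Subtype.val_injective,
    Set.ncard_image_of_injective _ Subtype.val_injective, Set.ncard_coe_finset,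
    Set.ncard_coe_finset, ← ZMod.natCast_eq_zero_iff_even, Nat.cast_add]
  have h2 : ((univ.filter fun a : A => (a : α) ∈ Y ∧ (a : α) ∈ T).card : ZMod 2) =
      ((univ.filter fun b : B => (b : α) ∈ Y).card : ZMod 2) := by
    have h3 := sum_filter_eq_card univ c (univ.filter fun a : A => (a : α) ∈ Y)
    have h4 : (univ.filter fun b : B => c b ∈ univ.filter fun a : A => (a : α) ∈ Y) =
        univ.filter fun b : B => (b : α) ∈ Y := by
      ext b
      simp [h.mem_iff_of_choice hpq hY hc b]
    rw [h4] at h3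
    rw [← h3, ← filter_filter, card_filter, Nat.cast_sum]
    refine Finset.sum_congr rfl fun a _ => ?_
    rw [hc.2 a, spineParity]
    split_ifs <;> simp
  rw [h2, CharTwo.add_self_eq_zero]

theorem mem_toggle {u v x : α} : x ∈ toggle T u v ↔ Xor (Xor (x ∈ T) (x = u)) (x = v) := by
  simp only [toggle, Set.mem_symmDiff, Set.mem_singleton_iff, Xor]

open Classical in
theorem cast_card_symmDiff {γ : Type*} (s t : Finset γ) :
    ((s ∆ t).card : ZMod 2) = s.card + t.card := by
  have h1 : (s ∆ t).card + 2 * (s ∩ t).card = s.card + t.card := by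
    have h2 : (s ∆ t).card = (s \ t).card + (t \ s).card := by
      rw [symmDiff_def, sup_eq_union, card_union_of_disjoint disjoint_sdiff_sdiff]
    have h3 := card_sdiff_add_card_inter s t
    have h4 := card_sdiff_add_card_inter t s
    rw [inter_comm] at h4
    omega
  have h2 := congrArg (Nat.cast : ℕ → ZMod 2) h1
  push_cast at h2
  rw [← h2, show (2 : ZMod 2) = 0 from rfl, zero_mul, add_zero]

/-- Toggling two teeth of the same factor-component does not increase `ν`. -/
theorem IsComb.nu_toggle_le (h : IsComb G T A B) (hpq : IsOrientation G A B p q)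
    (hE : E(G).Finite) (hr : ∀ b, r b ∈ toothNbrs G A B b) (hG₀ : G₀ ∈ factorComponents G T)
    {u v : B} (hu : (u : α) ∈ V(G₀)) (hv : (v : α) ∈ V(G₀)) :
    nu G (toggle T u v) ≤ nu G T := by
  classical
  obtain ⟨c, hc⟩ := h.exists_isCombChoice hpq r
  have hcv : (c v : α) ∈ V(G₀) :=
    (h.mem_iff_of_choice hpq (isFactorClosed_vertexSet hG₀) hc v).1 hv
  -- An obstruction would be a barrier containing `u` with `c v` in its even part, but `c v` and `u`
  -- are in the same factor-component.
  obtain ⟨c', hc'⟩ := TutteCondition.exists_isChoice_erase hr (IsChoice.tutteCondition hr hc)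
    (mem_univ u) (a := c v) (by
      intro R hR huR
      by_contra hodd
      have h1 := (h.isFactorClosed_evenVertices hpq hE hr hR).mem_of_factorConnected
        (factorConnected_of_mem hG₀ hcv hu) ((spine_mem_evenVertices h.disjoint _).2 hodd)
      exact ((tooth_mem_evenVertices h.disjoint u).1 h1).1 huR)
  obtain ⟨F, hFE, hcard, hdegp, hdegq, -⟩ := hpq.exists_edges hc'
  obtain ⟨e, he⟩ := mem_toothNbrs.1 (hc.1 v (mem_univ v))
  obtain ⟨hpe, hqe⟩ := hpq.eq_of_isLink he v.2
  -- Flipping an edge between `v` and `c v` undoes the toggle at `c v` and toggles `v`; it brings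
  -- the size from |B| - 1 to at most |B|.
  have hJ : IsJoin G (toggle T u v) ↑(F ∆ {e}) := by
    refine (hpq.isJoin_iff h.union_eq).2 ⟨?_, fun b hb => ?_, fun a ha => ?_⟩
    · intro f hf
      rcases mem_symmDiff.1 (mem_coe.1 hf) with ⟨hf, -⟩ | ⟨hf, -⟩
      · exact hFE hf
      · rw [mem_singleton.1 hf]; exact he.edge_mem
    · apply odd_iff_of_cast_eq
      have h1 : (F ∆ {e}).filter (fun f => p f = b) =
          (F.filter fun f => p f = b) ∆ (({e} : Finset β).filter fun f => p f = b) := by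
        ext f; simp only [mem_filter, mem_symmDiff]; tauto
      rw [h1, cast_card_symmDiff, hdegp ⟨b, hb⟩, filter_singleton, hpe, mem_toggle]
      have hbT := h.tooth_subset hb
      have h2 : (⟨b, hb⟩ : B) ∈ univ.erase u ↔ b ≠ u := by
        simp [Subtype.ext_iff]
      simp only [h2]
      have hvb : (v : α) = b ↔ b = v := eq_comm
      simp only [hvb]
      simp only [hbT, ne_eq]
      generalize (b = (u : α)) = P
      generalize (b = (v : α)) = Q
      by_cases hP : P <;> by_cases hQ : Q <;> simp [hP, hQ, Xor, CharTwo.add_self_eq_zero]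
    · apply odd_iff_of_cast_eq
      have h1 : (F ∆ {e}).filter (fun f => q f = a) =
          (F.filter fun f => q f = a) ∆ (({e} : Finset β).filter fun f => q f = a) := by
        ext f; simp only [mem_filter, mem_symmDiff]; tauto
      have hau : a ≠ u := fun h' => Set.disjoint_left.1 h.disjoint ha (h' ▸ u.2)
      have hav : a ≠ v := fun h' => Set.disjoint_left.1 h.disjoint ha (h' ▸ v.2)
      rw [h1, cast_card_symmDiff, hdegq ⟨a, ha⟩, filter_singleton, hqe, mem_toggle, toggleAt,
        spineParity]
      have h2 : (⟨a, ha⟩ : A) = c v ↔ (c v : α) = a := by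
        rw [Subtype.ext_iff]; exact eq_comm
      simp only [h2, hau, hav]
      by_cases hca : (c v : α) = a <;> simp [hca, add_assoc, CharTwo.add_self_eq_zero, Xor]
  refine (nu_le hJ).trans ?_
  rw [Set.encard_coe_eq_coe_finsetCard, h.nu_eq, ← Set.coe_fintypeCard]
  have h1 : (F ∆ {e}).card ≤ F.card + 1 := by
    rw [symmDiff_def, sup_eq_union]
    refine (card_union_le _ _).trans (add_le_add (card_le_card sdiff_subset) ?_)
    exact (card_le_card sdiff_subset).trans (card_singleton e).le
  rw [hcard, card_erase_of_mem (mem_univ u), card_univ] at h1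
  have : 0 < Fintype.card B := Fintype.card_pos_iff.2 ⟨u⟩
  exact_mod_cast (by omega : (F ∆ {e}).card ≤ Fintype.card B)

open Classical in
/-- Toggling two teeth of a barrier does not decrease `ν`. -/
theorem IsComb.le_nu_toggle (h : IsComb G T A B) (hpq : IsOrientation G A B p q)
    (hr : ∀ b, r b ∈ toothNbrs G A B b) {R : Finset B}
    (hR : IsBarrier (toothNbrs G A B) r univ (spineParity T A) R) {u v : B} (hu : u ∈ R)
    (hv : v ∈ R) (huv : u ≠ v) : nu G T ≤ nu G (toggle T u v) := by
  by_contra! hlt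
  rw [h.nu_eq, ← Set.coe_fintypeCard] at hlt
  have hle : nu G (toggle T u v) ≤ ((Fintype.card B - 1 : ℕ) : ℕ∞) := by
    have : 0 < Fintype.card B := Fintype.card_pos_iff.2 ⟨u⟩
    refine Order.le_of_lt_add_one (hlt.trans_le ?_)
    exact_mod_cast (by omega : Fintype.card B ≤ Fintype.card B - 1 + 1)
  obtain ⟨F, hF, hcard⟩ := exists_isJoin_of_nu_le hle
  obtain ⟨hFE, hodd, hodd'⟩ := (hpq.isJoin_iff h.union_eq).1 hF
  set I : Finset B := (univ.erase u).erase v with hI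
  have hIcard : I.card + 2 = Fintype.card B := by
    have h1 := card_erase_add_one (mem_erase.2 ⟨huv.symm, mem_univ v⟩)
    have h2 := card_erase_add_one (mem_univ u)
    rw [card_univ] at h2
    rw [← hI] at h1
    omega
  have hmem : ∀ b : B, (b : α) ∈ toggle T u v ↔ b ∈ I := by
    intro b
    have hbT := h.tooth_subset b.2
    have huv' : (u : α) ≠ v := fun h => huv (Subtype.ext h)
    rw [mem_toggle, hI, mem_erase, mem_erase]
    simp only [hbT, Xor, mem_univ, and_true, ne_eq, Subtype.ext_iff]
    by_cases hbu : (b : α) = u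
    · simp [hbu, huv']
    · simp [hbu]
  have hodd1 : ∀ b : B, Odd (F.filter fun e => p e = b).card ↔ b ∈ I := fun b =>
    (hodd b b.2).trans (hmem b)
  have hsum := hpq.sum_card_tooth hFE
  have hpar : (I.card : ZMod 2) = F.card := by
    rw [← hsum, Nat.cast_sum, Finset.sum_congr rfl fun b _ => cast_eq_of_odd_iff (hodd1 b)]
    simp
  -- A join with fewer than |B| edges has, by parity, at most |B| - 2 of them, so it is a choice on
  -- the teeth other than `u` and `v`.
  have hFI : F.card ≤ I.card := by
    by_contra! hlt'
    have := add_two_le_of_lt hlt' hpar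
    omega
  have hdeg := eq_ite_of_sum_le (fun b : B => (F.filter fun e => p e = b).card) I
    (fun b hb => ((hodd1 b).2 hb).pos) (hsum.trans_le hFI)
  obtain ⟨c, hc, -⟩ := hpq.exists_isChoice r hFE (I := I) (fun b => by convert hdeg b)
  refine hR.not_isChoice_erase_erase hr hu hv (c := c) ⟨hc.1, fun a => (hc.2 a).trans ?_⟩
  dsimp only
  rw [spineParity, cast_eq_of_odd_iff (hodd' a a.2)]
  have hau : (a : α) ≠ u := fun h' => Set.disjoint_left.1 h.disjoint a.2 (h' ▸ u.2)
  have hav : (a : α) ≠ v := fun h' => Set.disjoint_left.1 h.disjoint a.2 (h' ▸ v.2)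
  simp [mem_toggle, hau, hav, Xor]

end Comb

end Grafts

namespace Grafts

open Finset

/-! ### What a critical set provides. -/

section Critical

variable {α β : Type*} {G G₀ : Graph α β} {T A B X Y : Set α} {p q : β → α}

theorem contractVertex_of_mem {x : α} (hx : x ∈ X) : contractVertex X x = none := by
  simp [contractVertex, hx]

theorem contractVertex_of_notMem {x : α} (hx : x ∉ X) : contractVertex X x = some x := by
  simp [contractVertex, hx]

theorem contractVertex_eq_none {x : α} : contractVertex X x = none ↔ x ∈ X := by
  by_cases hx : x ∈ X <;> simp [contractVertex, hx]

theorem contractVertex_eq_some {x y : α} : contractVertex X x = some y ↔ x ∉ X ∧ x = y := by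
  by_cases hx : x ∈ X <;> simp [contractVertex, hx]

theorem some_mem_contractTerminals {x : α} : some x ∈ contractTerminals T X ↔ x ∈ T \ X := by
  simp [contractTerminals]

/-- The contracted vertex is a tooth of the quasicomb, so the spine end of each surviving edge lies
outside G₀ and the orientation is the same before and after contraction. -/
theorem IsCriticalSet.orientation (h : IsBipartiteGraft G T A B) (hpq : IsOrientation G A B p q)
    {p' q' : β → Option α}
    (hpq' : IsOrientation (contract (G.induce X) V(G₀)) (some '' ((A ∩ X) \ V(G₀)))
      (insert none (some '' ((B ∩ X) \ V(G₀)))) p' q') {e : β}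
    (he : e ∈ E(contract (G.induce X) V(G₀))) :
    e ∈ E(G) ∧ (p e ∈ X ∧ q e ∈ X \ V(G₀)) ∧ p' e = contractVertex V(G₀) (p e) ∧
      q' e = some (q e) := by
  have hl := hpq'.isLink e he
  obtain ⟨a, ⟨⟨haA, haX⟩, ha0⟩, ha⟩ := hpq'.right_mem e he
  simp only [contract, Graph.map_isLink, Relation.Map] at hl
  obtain ⟨x, y, hxy, hx, hy⟩ := hl
  simp only [Graph.deleteEdges_isLink, Graph.induce_isLink] at hxy
  obtain ⟨⟨hxy, hxX, hyX⟩, -⟩ := hxy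
  obtain ⟨hy0, rfl⟩ := contractVertex_eq_some.1 (hy.trans ha.symm)
  have hxB : x ∈ B := by
    rcases h.isLink e x y hxy with ⟨-, hyB⟩ | ⟨hxB, -⟩
    · exact absurd hyB (Set.disjoint_left.1 h.disjoint haA)
    · exact hxB
  obtain ⟨rfl, rfl⟩ := hpq.eq_of_isLink hxy hxB
  exact ⟨hxy.edge_mem, ⟨hxX, hyX, hy0⟩, hx.symm, ha.symm⟩

variable [Fintype A] [Fintype B] {r : B → A}

/-- V(G₀) is factor-closed and hence has an even number of terminals. The root therefore becomes a
terminal when it is toggled against another vertex. -/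
theorem IsComb.none_notMem_contractTerminals (h : IsComb G T A B) (hpq : IsOrientation G A B p q)
    (r : B → A) (hG₀ : G₀ ∈ factorComponents G T) (hX : V(G₀) ⊆ X) :
    none ∉ contractTerminals (T ∩ X) V(G₀) := by
  rintro (⟨x, -, hx⟩ | ⟨-, hodd⟩)
  · cases hx
  · obtain ⟨c, hc⟩ := h.exists_isCombChoice hpq r
    have h1 := h.even_ncard_inter hpq hc (isFactorClosed_vertexSet hG₀)
      fun x hx => mem_vertexSet_of_mem hG₀ hx
    have h2 : V(G₀) ∩ (T ∩ X) = V(G₀) ∩ T := by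
      ext x
      exact ⟨fun hx => ⟨hx.1, hx.2.1⟩, fun hx => ⟨hx.1, hx.2, hX hx.1⟩⟩
    rw [h2] at hodd
    exact (Nat.not_odd_iff_even.2 h1) hodd

theorem none_mem_toggle {T' : Set (Option α)} (hT' : none ∉ T') (x : α) :
    none ∈ toggle T' (some x) none := by
  simp [mem_toggle, hT', Xor]

/-- A factor-component with a nontrivial critical set contains a tooth. -/
theorem IsCriticalSet.exists_tooth (h : IsComb G T A B) (hpq : IsOrientation G A B p q)
    (r : B → A) (hG₀ : G₀ ∈ factorComponents G T) (hX : IsCriticalSet G T A B G₀ X) {x : α}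
    (hx : x ∈ X) (hx0 : x ∉ V(G₀)) : ∃ u : B, (u : α) ∈ V(G₀) := by
  classical
  obtain ⟨p', q', hpq'⟩ := hX.critical.exists_orientation
  have hnone := h.none_notMem_contractTerminals hpq r hG₀ hX.subset
  have hfin : (insert none (some '' ((B ∩ X) \ V(G₀)))).Finite :=
    (((Set.toFinite B).subset fun y hy => hy.1.1).image _).insert _
  have hnu : ∃ n : ℕ, nu (contract (G.induce X) V(G₀)) (contractTerminals (T ∩ X) V(G₀)) ≤ n := by
    rw [hX.critical.nu_eq, ← (hfin.inter_of_left _).cast_ncard_eq]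
    exact ⟨_, le_rfl⟩
  obtain ⟨n, hn⟩ := hnu
  have hle : nu (contract (G.induce X) V(G₀))
      (toggle (contractTerminals (T ∩ X) V(G₀)) (some x) none) ≤ ((n + 1 : ℕ) : ℕ∞) := by
    push_cast
    rcases (h.union_eq.symm ▸ hX.separating.subset hx : x ∈ A ∪ B) with hA | hB
    · rw [hX.critical.spine (some x) ⟨x, ⟨⟨hA, hx⟩, hx0⟩, rfl⟩]
      gcongr
    · rw [hX.critical.tooth (some x) (Or.inr ⟨x, ⟨⟨hB, hx⟩, hx0⟩, rfl⟩)]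
      exact hn.trans le_self_add
  obtain ⟨J, hJ, -⟩ := exists_isJoin_of_nu_le hle
  obtain ⟨hJE, hodd, -⟩ := (hpq'.isJoin_iff hX.critical.union_eq).1 hJ
  -- The toggled root is a terminal, so the join has an edge at it, and in `G` the tooth end of that
  -- edge lies in G₀.
  have h1 := ((hodd none (Or.inl rfl)).2 (none_mem_toggle hnone x)).pos
  obtain ⟨e, he⟩ := card_pos.1 h1
  obtain ⟨he, hp⟩ := (@mem_filter _ _ (_) _ _).1 he
  obtain ⟨heG, -, hpe, -⟩ := IsCriticalSet.orientation h.toIsBipartiteGraft hpq hpq' (hJE he)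
  exact ⟨⟨p e, hpq.left_mem e heG⟩, contractVertex_eq_none.1 (hpe ▸ hp)⟩

open Classical in
/-- The use of a critical set: a tooth `b` of the critical set can be left out, at the cost of an
additional edge from the critical set to a tooth of `G₀`. -/
theorem IsCriticalSet.exists_isChoice_erase (h : IsComb G T A B) (hpq : IsOrientation G A B p q)
    (r : B → A) (hG₀ : G₀ ∈ factorComponents G T)
    (hX : IsCriticalSet G T A B G₀ X) {b : B} (hb : (b : α) ∈ X) (hb0 : (b : α) ∉ V(G₀)) :
    ∃ u : B, (u : α) ∈ V(G₀) ∧ ∃ a ∈ toothNbrs G A B u, ∃ c,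
      IsChoice (toothNbrs G A B) (univ.erase b) (toggleAt (spineParity T A) a) c := by
  obtain ⟨p', q', hpq'⟩ := hX.critical.exists_orientation
  have hnone := h.none_notMem_contractTerminals hpq r hG₀ hX.subset
  have hor := fun {e} => IsCriticalSet.orientation (e := e) h.toIsBipartiteGraft hpq hpq'
  have hcrit := hX.critical
  set Q := contract (G.induce X) V(G₀) with hQ
  set T' := contractTerminals (T ∩ X) V(G₀) with hT'
  set A' : Set (Option α) := some '' ((A ∩ X) \ V(G₀)) with hA'
  set B' : Set (Option α) := insert none (some '' ((B ∩ X) \ V(G₀))) with hB'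
  have hBfin : B'.Finite :=
    (((Set.toFinite B).subset fun y hy => hy.1.1).image _).insert _
  have : Fintype B' := hBfin.fintype
  have : Fintype A' := (((Set.toFinite A).subset fun y hy => hy.1.1).image _).fintype
  have hbB' : some (b : α) ∈ B' := Or.inr ⟨b, ⟨⟨b.2, hb⟩, hb0⟩, rfl⟩
  set I : Finset B' := univ.erase ⟨some b, hbB'⟩ with hI
  have hIcard : I.card + 1 = Fintype.card B' := by
    rw [hI, card_erase_add_one (mem_univ _), card_univ]
  -- After toggling, the terminal teeth are those of `I`. Since the root was no terminal before, ν
  -- is at most |I|, so a minimum join has exactly one edge at each tooth of `I` and none at `b`.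
  have hnu : nu Q (toggle T' (some b) none) ≤ (I.card : ℕ∞) := by
    rw [hcrit.tooth _ hbB', hcrit.nu_eq]
    have h1 : (B' ∩ T').encard + 1 ≤ (I.card : ℕ∞) + 1 := by
      rw [← Set.encard_insert_of_notMem (a := none) (fun hn => hnone hn.2)]
      have h2 : ((I.card : ℕ∞) + 1) = B'.encard := by
        rw [← Set.coe_fintypeCard]
        exact_mod_cast hIcard
      rw [h2]
      exact Set.encard_le_encard (Set.insert_subset (Or.inl rfl) Set.inter_subset_left)
    exact (ENat.add_le_add_iff_right ENat.one_ne_top).1 h1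
  obtain ⟨J, hJ, hJcard⟩ := exists_isJoin_of_nu_le hnu
  obtain ⟨hJE, hoddp, hoddq⟩ := (hpq'.isJoin_iff hcrit.union_eq).1 hJ
  have hIodd : ∀ x ∈ I, 1 ≤ (J.filter fun e => p' e = x).card := by
    rintro ⟨x, hx⟩ hxI
    have hxb : x ≠ some (b : α) := fun h' => ne_of_mem_erase hxI (Subtype.ext h')
    suffices hmem : x ∈ toggle T' (some (b : α)) none by
      convert Nat.succ_le_of_lt ((hoddp x hx).2 hmem).pos
    rcases hx with rfl | ⟨y, hy, rfl⟩
    · exact none_mem_toggle hnone b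
    · have : some y ∈ T' := some_mem_contractTerminals.2
        ⟨⟨h.tooth_subset hy.1.1, hy.1.2⟩, hy.2⟩
      simp [mem_toggle, this, hxb, Xor]
  have hdeg := eq_ite_of_sum_le (fun x : B' => (J.filter fun e => p' e = x).card) I hIodd
    (le_of_eq_of_le (by convert hpq'.sum_card_tooth hJE) hJcard)
  have hnoneI : (⟨none, Or.inl rfl⟩ : B') ∈ I :=
    mem_erase.2 ⟨fun h' => Option.some_ne_none _ (congrArg Subtype.val h').symm, mem_univ _⟩
  have hdeg0 := hdeg ⟨none, Or.inl rfl⟩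
  simp only [hnoneI, if_true, card_eq_one] at hdeg0
  obtain ⟨e₀, he₀⟩ := hdeg0
  have he₀J : e₀ ∈ J ∧ p' e₀ = none := by
    have : e₀ ∈ J.filter fun e => p' e = none := he₀ ▸ mem_singleton_self e₀
    exact mem_filter.1 this
  have he₀u : ∀ e ∈ J, p' e = none → e = e₀ := fun e he hp =>
    mem_singleton.1 (he₀ ▸ mem_filter.2 ⟨he, hp⟩)
  obtain ⟨he₀G, ⟨-, he₀q⟩, he₀p, -⟩ := hor (hJE he₀J.1)
  have hu0 : p e₀ ∈ V(G₀) := contractVertex_eq_none.1 (he₀p ▸ he₀J.2)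
  refine ⟨⟨p e₀, hpq.left_mem _ he₀G⟩, hu0, ⟨q e₀, hpq.right_mem _ he₀G⟩,
    mem_toothNbrs.2 (hpq.isLink _ he₀G).adj, ?_⟩
  obtain ⟨c, hc⟩ := h.exists_isCombChoice hpq r
  obtain ⟨F, hF, -⟩ := h.exists_allowed_of_choice hpq hc
  have hFE : (F : Set β) ⊆ E(G) := hF.1.1
  have hYcl := hX.separating.isFactorClosed.sdiff (isFactorClosed_vertexSet hG₀)
  have hFY : ∀ e ∈ F, p e ∈ X \ V(G₀) ↔ q e ∈ X \ V(G₀) := fun e he =>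
    hYcl.mem_iff ⟨F, hF, he⟩ (hpq.isLink e (hFE he))
  have hJp : ∀ e ∈ J, e ≠ e₀ → p e ∈ X \ V(G₀) := by
    intro e he hne
    obtain ⟨-, ⟨hpX, -⟩, hpe, -⟩ := hor (hJE he)
    exact ⟨hpX, fun hp0 => hne (he₀u e he (hpe.trans (contractVertex_of_mem hp0)))⟩
  -- `J` without its root edge is used on X \ V(G₀), and a minimum join elsewhere; the latter has no
  -- edge across, since this set is factor-closed. Omitting `e₀` toggles its spine end.
  set F' := J.erase e₀ ∪ F.filter fun e => p e ∉ X \ V(G₀) with hF'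
  have hF'E : (F' : Set β) ⊆ E(G) := by
    intro e he
    rcases mem_union.1 (mem_coe.1 he) with he | he
    · exact (hor (hJE (mem_of_mem_erase he))).1
    · exact hFE (mem_filter.1 he).1
  have hF'deg : ∀ b' : B, (F'.filter fun e => p e = b').card =
      if b' ∈ univ.erase b then 1 else 0 := by
    intro b'
    by_cases hb' : (b' : α) ∈ X \ V(G₀)
    · have hb'B : some (b' : α) ∈ B' := Or.inr ⟨b', ⟨⟨b'.2, hb'.1⟩, hb'.2⟩, rfl⟩
      have h1 : (F'.filter fun e => p e = b') = J.filter fun e => p' e = some (b' : α) := by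
        ext e
        simp only [hF', mem_filter, mem_union, mem_erase]
        constructor
        · rintro ⟨⟨-, he⟩ | ⟨-, he⟩, hp⟩
          · refine ⟨he, ?_⟩
            rw [(hor (hJE he)).2.2.1, hp, contractVertex_of_notMem hb'.2]
          · exact absurd (hp ▸ hb') he
        · rintro ⟨he, hp⟩
          have hne : e ≠ e₀ := by
            rintro rfl
            rw [he₀J.2] at hp
            cases hp
          rw [(hor (hJE he)).2.2.1, contractVertex_eq_some] at hp
          exact ⟨Or.inl ⟨hne, he⟩, hp.2⟩
      rw [h1, hdeg ⟨some b', hb'B⟩]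
      simp [hI, Subtype.ext_iff]
    · have h1 : (F'.filter fun e => p e = b') = F.filter fun e => p e = b' := by
        ext e
        simp only [hF', mem_filter, mem_union, mem_erase]
        constructor
        · rintro ⟨⟨hne, he⟩ | ⟨he, -⟩, hp⟩
          · exact absurd (hp ▸ hJp e he hne) hb'
          · exact ⟨he, hp⟩
        · rintro ⟨he, hp⟩
          exact ⟨Or.inr ⟨he, hp ▸ hb'⟩, hp⟩
      have hne : b' ≠ b := by
        rintro rfl
        exact hb' ⟨hb, hb0⟩
      rw [h1, h.card_tooth_eq_one hpq hF]
      simp [hne]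
  obtain ⟨c', hc', -⟩ := hpq.exists_isChoice r hF'E hF'deg
  refine ⟨c', hc'.1, fun a => (hc'.2 a).trans ?_⟩
  dsimp only
  rw [toggleAt]
  by_cases ha : (a : α) ∈ X \ V(G₀)
  · have haA' : some (a : α) ∈ A' := ⟨a, ⟨⟨a.2, ha.1⟩, ha.2⟩, rfl⟩
    have h1 : (F'.filter fun e => q e = a) = (J.filter fun e => q' e = some (a : α)).erase e₀ := by
      ext e
      simp only [hF', mem_filter, mem_union, mem_erase]
      constructor
      · rintro ⟨⟨hne, he⟩ | ⟨he, hp⟩, hq⟩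
        · exact ⟨hne, he, by rw [(hor (hJE he)).2.2.2, hq]⟩
        · exact absurd ((hFY e he).2 (hq ▸ ha)) hp
      · rintro ⟨hne, he, hq⟩
        rw [(hor (hJE he)).2.2.2, Option.some_inj] at hq
        exact ⟨Or.inl ⟨hne, he⟩, hq⟩
    have hab : (a : α) ≠ b := fun h' => Set.disjoint_left.1 h.disjoint a.2 (h' ▸ b.2)
    have h2 : ((J.filter fun e => q' e = some (a : α)).card : ZMod 2) = spineParity T A a := by
      have : some (a : α) ∈ toggle T' (some b) none ↔ (a : α) ∈ T := by
        simp [mem_toggle, hT', some_mem_contractTerminals, ha.1, ha.2, hab, Xor]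
      rw [spineParity]
      convert cast_eq_of_odd_iff ((hoddq _ haA').trans this)
    rw [h1, ← h2]
    by_cases hae : a = ⟨q e₀, hpq.right_mem _ he₀G⟩
    · have hmem : e₀ ∈ J.filter fun e => q' e = some (a : α) := by
        refine mem_filter.2 ⟨he₀J.1, ?_⟩
        rw [(hor (hJE he₀J.1)).2.2.2, hae]
      rw [if_pos hae, ← card_erase_add_one hmem, Nat.cast_add, Nat.cast_one, add_assoc,
        CharTwo.add_self_eq_zero, add_zero]
    · have hmem : e₀ ∉ J.filter fun e => q' e = some (a : α) := by
        intro hmem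
        have := (mem_filter.1 hmem).2
        rw [(hor (hJE he₀J.1)).2.2.2, Option.some_inj] at this
        exact hae (Subtype.ext this.symm)
      rw [if_neg hae, erase_eq_of_notMem hmem, add_zero]
  · have h1 : (F'.filter fun e => q e = a) = F.filter fun e => q e = a := by
      ext e
      simp only [hF', mem_filter, mem_union, mem_erase]
      constructor
      · rintro ⟨⟨-, he⟩ | ⟨he, -⟩, hq⟩
        · exact absurd (hq ▸ (hor (hJE he)).2.1.2) ha
        · exact ⟨he, hq⟩
      · rintro ⟨he, hq⟩
        exact ⟨Or.inr ⟨he, fun hp => ha (hq ▸ (hFY e he).1 hp)⟩, hq⟩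
    have hae : a ≠ ⟨q e₀, hpq.right_mem _ he₀G⟩ := by
      rintro rfl
      exact ha he₀q
    rw [h1, if_neg hae, add_zero]
    exact spineParity_eq_of_isJoin hpq h.union_eq hF.1 a

end Critical

end Grafts

namespace Grafts

open Finset

/-! ### Maximal barriers and the teeth of G₀ adjacent to K. -/

section Main

variable {α β : Type*} {G G₀ : Graph α β} {T A B U X Y : Set α} {p q : β → α} {r : B → A}

/-- The vertices of the part of the hypergraph of teeth outside `S` given by the set `D` of
spine vertices. -/
def partVertices (r : B → A) (S : Finset B) (D : Finset A) : Set α :=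
  {x | (∃ z : A, (z : α) = x ∧ z ∈ D) ∨ ∃ b : B, (b : α) = x ∧ b ∉ S ∧ r b ∈ D}

theorem spine_mem_partVertices (hd : Disjoint A B) {S : Finset B} {D : Finset A} {z : A} :
    (z : α) ∈ partVertices r S D ↔ z ∈ D := by
  constructor
  · rintro (⟨z', hz, h⟩ | ⟨b, hb, -⟩)
    · rwa [← Subtype.ext hz]
    · exact absurd (hb ▸ b.2) (Set.disjoint_left.1 hd z.2)
  · exact fun h => Or.inl ⟨z, rfl, h⟩

theorem tooth_mem_partVertices (hd : Disjoint A B) {S : Finset B} {D : Finset A} {b : B} :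
    (b : α) ∈ partVertices r S D ↔ b ∉ S ∧ r b ∈ D := by
  constructor
  · rintro (⟨z, hz, -⟩ | ⟨b', hb, h⟩)
    · exact absurd b.2 (Set.disjoint_left.1 hd (hz ▸ z.2))
    · rwa [← Subtype.ext hb]
  · exact fun h => Or.inr ⟨b, rfl, h⟩

/-- The edge survives the contraction, where its end in G₀ becomes the root, which is a tooth. -/
theorem IsCriticalSet.spine_tooth_of_adj (h : IsBipartiteGraft G T A B)
    (hpq : IsOrientation G A B p q) (hX : IsCriticalSet G T A B G₀ X) {x y : α} (hx : x ∈ X)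
    (hx0 : x ∉ V(G₀)) (hy : y ∈ V(G₀)) (hxy : G.Adj x y) : x ∈ A ∧ y ∈ B := by
  obtain ⟨p', q', hpq'⟩ := hX.critical.exists_orientation
  obtain ⟨e, he⟩ := hxy
  have heX : e ∈ E(contract (G.induce X) V(G₀)) := by
    have hl : (contract (G.induce X) V(G₀)).IsLink e (contractVertex V(G₀) x)
        (contractVertex V(G₀) y) := by
      rw [contract, Graph.map_isLink]
      refine ⟨x, y, ?_, rfl, rfl⟩
      rw [Graph.deleteEdges_isLink]
      refine ⟨⟨he, hx, hX.subset hy⟩, fun h' => ?_⟩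
      obtain ⟨x', y', ⟨he', -, -⟩, hx', hy'⟩ := Graph.exists_isLink_of_mem_edgeSet h'
      rcases he'.eq_and_eq_or_eq_and_eq he with ⟨rfl, rfl⟩ | ⟨rfl, rfl⟩
      · exact hx0 hx'
      · exact hx0 hy'
    exact hl.edge_mem
  obtain ⟨-, ⟨-, hq⟩, -, -⟩ := IsCriticalSet.orientation h hpq hpq' heX
  rcases h.isLink e x y he with hAB | ⟨hxB, -⟩
  · exact hAB
  · obtain ⟨-, rfl⟩ := hpq.eq_of_isLink he hxB
    exact absurd hy hq.2

variable [Fintype A] [Fintype B]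

open Classical in
/-- Two choices can be spliced along a factor-closed set. -/
theorem IsComb.isCombChoice_piecewise (h : IsComb G T A B) (hpq : IsOrientation G A B p q)
    (hY : IsFactorClosed G T Y) {c c' : B → A} (hc : IsCombChoice G T A B c)
    (hc' : IsCombChoice G T A B c') :
    IsCombChoice G T A B fun b => if (b : α) ∈ Y then c' b else c b := by
  refine ⟨fun b _ => ?_, fun a => ?_⟩
  · dsimp only
    split_ifs
    · exact hc'.1 b (mem_univ b)
    · exact hc.1 b (mem_univ b)
  · have hcY := h.mem_iff_of_choice hpq hY hc
    have hcY' := h.mem_iff_of_choice hpq hY hc'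
    by_cases ha : (a : α) ∈ Y
    · rw [← hc'.2 a]
      congr 2
      ext b
      by_cases hb : (b : α) ∈ Y
      · simp [hb]
      · have h1 : c b ≠ a := fun h' => hb ((hcY b).2 (h' ▸ ha))
        have h2 : c' b ≠ a := fun h' => hb ((hcY' b).2 (h' ▸ ha))
        simp [hb, h1, h2]
    · rw [← hc.2 a]
      congr 2
      ext b
      by_cases hb : (b : α) ∈ Y
      · have h1 : c b ≠ a := fun h' => ha (h' ▸ (hcY b).1 hb)
        have h2 : c' b ≠ a := fun h' => ha (h' ▸ (hcY' b).1 hb)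
        simp [hb, h1, h2]
      · simp [hb]

open Classical in
/-- A walk that starts in a part and does not stay in it meets `S`. -/
theorem IsBipartiteGraft.exists_mem_of_walk (h : IsBipartiteGraft G T A B)
    (hr : ∀ b, r b ∈ toothNbrs G A B b) {S : Finset B} {a₀ : A} {x y : α}
    (hw : Relation.ReflTransGen (G.induce U).Adj x y)
    (hx : x ∈ partVertices r S (component (toothNbrs G A B) (univ \ S) a₀)) :
    y ∈ partVertices r S (component (toothNbrs G A B) (univ \ S) a₀) ∨
      ∃ b ∈ S, (b : α) ∈ U ∧ ∃ z ∈ toothNbrs G A B b,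
        z ∈ component (toothNbrs G A B) (univ \ S) a₀ := by
  set D := component (toothNbrs G A B) (univ \ S) a₀ with hD
  induction hw with
  | refl => exact Or.inl hx
  | @tail y w _ hyw ih =>
    refine ih.elim (fun hy => ?_) Or.inr
    obtain ⟨e, he, hyU, hwU⟩ := hyw
    have hmem : ∀ b : B, b ∉ S → ∀ z ∈ toothNbrs G A B b, (r b ∈ D ↔ z ∈ D) := by
      intro b hb z hz
      have hbS : b ∈ univ \ S := mem_sdiff.2 ⟨mem_univ b, hb⟩
      rw [hD, mem_component_comm, mem_component_comm,
        component_eq (subset_component hbS hz (hr b))]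
    rcases h.isLink e y w he with ⟨hyA, hwB⟩ | ⟨hyB, hwA⟩
    · have hyD := (spine_mem_partVertices (z := ⟨y, hyA⟩) h.disjoint).1 hy
      have hyN : (⟨y, hyA⟩ : A) ∈ toothNbrs G A B ⟨w, hwB⟩ := mem_toothNbrs.2 ⟨e, he.symm⟩
      by_cases hwS : (⟨w, hwB⟩ : B) ∈ S
      · exact Or.inr ⟨_, hwS, hwU, _, hyN, hyD⟩
      · exact Or.inl ((tooth_mem_partVertices (b := ⟨w, hwB⟩) h.disjoint).2
          ⟨hwS, (hmem _ hwS _ hyN).2 hyD⟩)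
    · obtain ⟨hyS, hyD⟩ := (tooth_mem_partVertices (b := ⟨y, hyB⟩) h.disjoint).1 hy
      exact Or.inl ((spine_mem_partVertices (z := ⟨w, hwA⟩) h.disjoint).2
        ((hmem _ hyS _ (mem_toothNbrs.2 ⟨e, he⟩)).1 hyD))

open Classical in
/-- A maximal barrier with a tooth of `G₀` contains all teeth of `G₀` that see the same
connected part of the union `U` of critical sets. -/
theorem IsComb.mem_of_maximal (h : IsComb G T A B) (hpq : IsOrientation G A B p q)
    (hE : E(G).Finite) (hr : ∀ b, r b ∈ toothNbrs G A B b) (hG₀ : G₀ ∈ factorComponents G T)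
    (hU : ∀ x ∈ U, ∃ X, IsCriticalSet G T A B G₀ X ∧ x ∈ X ∧ x ∉ V(G₀)) {S : Finset B}
    (hS : Maximal (IsBarrier (toothNbrs G A B) r univ (spineParity T A)) S) {u v : B} {a a' : A}
    (huS : u ∈ S) (hu : (u : α) ∈ V(G₀)) (hv : (v : α) ∈ V(G₀)) (ha : a ∈ toothNbrs G A B u)
    (ha' : a' ∈ toothNbrs G A B v) (haU : (a : α) ∈ U)
    (hw : Relation.ReflTransGen (G.induce U).Adj a' a) : v ∈ S := by
  by_contra hvS
  have hvI : v ∈ univ \ S := mem_sdiff.2 ⟨mem_univ v, hvS⟩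
  set D := component (toothNbrs G A B) (univ \ S) a' with hD
  have hrv : r v ∈ D := subset_component hvI ha' (hr v)
  obtain ⟨c₀, hc₀⟩ := h.exists_isCombChoice hpq r
  have htutte := IsChoice.tutteCondition hr hc₀
  -- If `D` were even, `v` and hence `u` would be in the even part of `S`, although `u ∈ S`.
  have hDodd : D ∈ oddComponents (toothNbrs G A B) r (univ \ S) (spineParity T A) := by
    by_contra hodd
    have h1 : (v : α) ∈ evenVertices G T A B r S := by
      rw [tooth_mem_evenVertices h.disjoint]
      exact ⟨hvS, by rwa [component_eq hrv]⟩
    have h2 := (h.isFactorClosed_evenVertices hpq hE hr hS.prop).mem_of_factorConnected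
      (factorConnected_of_mem hG₀ hv hu) h1
    exact ((tooth_mem_evenVertices h.disjoint u).1 h2).1 huS
  have hcomp : ∀ z ∈ D, component (toothNbrs G A B) (univ \ S) z = D := fun z hz =>
    component_eq hz
  -- Putting hyperedges back enlarges `D`; if the enlarged component is even, then `v`, and with it
  -- all of G₀, is in the even part of `R`.
  have heven : ∀ R ⊆ S, IsBarrier (toothNbrs G A B) r univ (spineParity T A) R → ∀ z ∈ D,
      component (toothNbrs G A B) (univ \ R) z ∉
        oddComponents (toothNbrs G A B) r (univ \ R) (spineParity T A) →
      ∀ w : B, (w : α) ∈ V(G₀) →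
        InEvenPart (toothNbrs G A B) r univ (spineParity T A) R w := by
    intro R hRS hR z hz hzR w hw
    have h1 : (v : α) ∈ evenVertices G T A B r R := by
      rw [tooth_mem_evenVertices h.disjoint]
      refine ⟨fun hvR => hvS (hRS hvR), ?_⟩
      have hvz : r v ∈ component (toothNbrs G A B) (univ \ S) z := (hcomp z hz).symm ▸ hrv
      rwa [component_eq (component_mono (sdiff_subset_sdiff subset_rfl hRS) hvz)]
    exact (tooth_mem_evenVertices h.disjoint w).1
      ((h.isFactorClosed_evenVertices hpq hE hr hR).mem_of_factorConnected
        (factorConnected_of_mem hG₀ hv hw) h1)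
  have hG₀cl := isFactorClosed_vertexSet hG₀
  have hinit : (a' : α) ∈ partVertices r S D :=
    (spine_mem_partVertices h.disjoint).2 mem_component_self
  rcases h.exists_mem_of_walk hr hw hinit with haD | ⟨b, hbS, hbU, z, hz, hzD⟩
  · have haD := (spine_mem_partVertices h.disjoint).1 haD
    rcases htutte.exists_isChoice_or_barrier hr hS huS ha
      ((hcomp a haD).symm ▸ hDodd) with ⟨c, hc, hcu⟩ | ⟨R, hRS, huR, hR, hRa⟩
    -- An allowed edge from `u` to `a` would put `a` in G₀.
    · obtain ⟨-, -, -, ha0⟩ := hU a haU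
      exact ha0 (hcu ▸ (h.mem_iff_of_choice hpq hG₀cl hc u).1 hu)
    · exact (heven R hRS hR a haD hRa u hu).1 huR
  · obtain ⟨X, hX, hbX, hb0⟩ := hU b hbU
    rcases htutte.exists_isChoice_or_barrier hr hS hbS hz
      ((hcomp z hzD).symm ▸ hDodd) with ⟨c, hc, hcb⟩ | ⟨R, hRS, hbR, hR, hRz⟩
    -- This set contains `v` but not `u`, so some allowed edge must leave it; the contradiction is
    -- that none does.
    · have hW : ¬ IsFactorClosed G T (V(G₀) ∩ partVertices r S D) := fun hW =>
        ((tooth_mem_partVertices h.disjoint).1 (hW.mem_of_factorConnected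
          (factorConnected_of_mem hG₀ hv hu)
          ⟨hv, (tooth_mem_partVertices h.disjoint).2 ⟨hvS, hrv⟩⟩).2).1 huS
      refine hW (h.isFactorClosed_of_choice hpq hE r fun c' hc' b₁ => ?_)
      have hcl := h.mem_iff_of_choice hpq hG₀cl hc' b₁
      rw [Set.mem_inter_iff, Set.mem_inter_iff, ← hcl]
      refine and_congr_right fun hb₁ => ?_
      rw [tooth_mem_partVertices h.disjoint, spine_mem_partVertices h.disjoint]
      by_cases hb₁S : b₁ ∈ S
      · refine iff_of_false (fun h' => h'.1 hb₁S) fun hD₁ => hb0 ?_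
        -- With `c'` inside G₀ and `c` outside, both `b₁` and `b` choose in `D`, so they coincide by
        -- injectivity on the barrier; but `b` is outside G₀.
        have hsp := h.isCombChoice_piecewise hpq hG₀cl hc hc'
        have := hS.prop.injOn hr hsp hbS hb₁S (by
          simp only [hb0, hb₁, if_true, if_false, hcb]
          rw [hcomp z hzD, hcomp _ hD₁])
        rwa [this]
      · simp only [hb₁S, not_false_eq_true, true_and]
        have hbI : b₁ ∈ univ \ S := mem_sdiff.2 ⟨mem_univ b₁, hb₁S⟩
        rw [hD, mem_component_comm, mem_component_comm,
          component_eq (subset_component hbI (hc'.1 b₁ (mem_univ b₁)) (hr b₁))]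
    -- Criticality allows omitting `b` at the cost of toggling `a₁`. As `w` is in the even part of
    -- `R`, so is its neighbour `a₁`, and no such choice exists because `b ∈ R`.
    · obtain ⟨w, hw0, a₁, ha₁, c, hc⟩ := hX.exists_isChoice_erase h hpq r hG₀ hbX hb0
      obtain ⟨hwR, hwodd⟩ := heven R hRS hR z hzD hRz w hw0
      refine hR.not_isChoice_erase hr hbR ?_ hc
      rwa [component_eq (subset_component (mem_sdiff.2 ⟨mem_univ w, hwR⟩) (hr w) ha₁)]

open Classical in
/-- The vertices equivalent to a tooth are teeth. -/
theorem IsComb.mem_tooth_of_nu_toggle (h : IsComb G T A B) (hpq : IsOrientation G A B p q)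
    {b : B} {x : α} (hnu : nu G (toggle T b x) = nu G T) : x ∈ B := by
  by_contra hxB
  rw [h.nu_eq, ← Set.coe_fintypeCard] at hnu
  obtain ⟨J, hJ, hcard⟩ := exists_isJoin_of_nu_le (n := Fintype.card B) hnu.le
  obtain ⟨hJE, hodd, -⟩ := (hpq.isJoin_iff h.union_eq).1 hJ
  have hodd1 : ∀ b' : B, Odd (J.filter fun e => p e = b').card ↔ b' ∈ univ.erase b := by
    intro b'
    have hb'T := h.tooth_subset b'.2
    have hne : (b' : α) ≠ x := fun h' => hxB (h' ▸ b'.2)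
    rw [hodd b' b'.2, mem_toggle, mem_erase]
    simp [hb'T, hne, Xor, Subtype.ext_iff]
  -- With `x` outside B, the teeth of odd degree are all but `b`, so |J| has the parity of |B| - 1,
  -- while |J| = |B|.
  have hpar : ((univ.erase b).card : ZMod 2) = J.card := by
    rw [← hpq.sum_card_tooth hJE, Nat.cast_sum,
      Finset.sum_congr rfl fun b' _ => cast_eq_of_odd_iff (hodd1 b'), Finset.sum_boole]
    simp only [mem_erase, mem_univ, and_true]
    congr 2
    ext
    simp
  have hI := card_erase_add_one (mem_univ b)
  rw [card_univ] at hI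
  have hle : Fintype.card B ≤ J.card := by
    have := nu_le hJ
    rw [hnu, Set.encard_coe_eq_coe_finsetCard] at this
    exact_mod_cast this
  have := add_two_le_of_lt (by omega : (univ.erase b).card < J.card) hpar
  omega

end Main

end Grafts

/-! ### The main theorem. -/

theorem mainTheorem4 {α β : Type*} (G : Graph α β)
    (hV : Set.Finite (Graph.vertexSet G)) (hE : Set.Finite (Graph.edgeSet G))
    (T A B : Set α) (hcomb : Grafts.IsComb G T A B)
    (G₀ : Graph α β) (hG₀ : G₀ ∈ Grafts.factorComponents G T)
    (K : Graph α β)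
    (hK : K ∈ Grafts.connectedComponents
      (G.induce (Grafts.strictUpperVertices G T A B G₀))) :
    ∃ S ∈ Grafts.klClassesOf G T G₀, S ⊆ B ∧
      Grafts.neighbors G (Graph.vertexSet K) ∩ Graph.vertexSet G₀ ⊆ S := by
  classical
  obtain ⟨k, hk, rfl⟩ := hK
  set U := Grafts.strictUpperVertices G T A B G₀ with hUdef
  have hkU : k ∈ U := hk
  have : Nonempty α := ⟨k⟩
  obtain ⟨p, q, hpq⟩ := hcomb.exists_orientation
  have : Fintype A := (hV.subset (hcomb.union_eq ▸ Set.subset_union_left)).fintype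
  have : Fintype B := (hV.subset (hcomb.union_eq ▸ Set.subset_union_right)).fintype
  obtain ⟨r, hr⟩ := hcomb.exists_nbr hpq
  have hU : ∀ x ∈ U, ∃ X, Grafts.IsCriticalSet G T A B G₀ X ∧ x ∈ X ∧ x ∉ V(G₀) := by
    rintro x ⟨H, hH, ⟨X, hX, hHX⟩, hne, hxH⟩
    exact ⟨X, hX, hHX hxH, fun hx0 => hne (Grafts.factorComponents_eq_of_mem hH hG₀ hxH hx0)⟩
  set KV : Set α := {x | Relation.ReflTransGen (G.induce U).Adj k x} with hKV
  have hKU : KV ⊆ U := by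
    intro x hx
    rcases Relation.ReflTransGen.cases_tail hx with rfl | ⟨z, -, hz⟩
    · exact hkU
    · exact hz.right_mem
  have hlink : ∀ x ∈ KV, ∀ y ∈ KV, Relation.ReflTransGen (G.induce U).Adj x y := by
    intro x hx y hy
    have : Std.Symm (G.induce U).Adj := ⟨fun _ _ h => h.symm⟩
    exact (Relation.ReflTransGen.stdSymm.symm k x hx).trans hy
  set N := Grafts.neighbors G KV ∩ V(G₀) with hN
  have hNB : ∀ y ∈ N, y ∈ V(G₀) ∧ ∃ hyB : y ∈ B, ∃ a : A, (a : α) ∈ KV ∧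
      a ∈ Grafts.toothNbrs G A B ⟨y, hyB⟩ := by
    rintro y ⟨⟨-, x, hx, hxy⟩, hy⟩
    obtain ⟨X, hX, hxX, hx0⟩ := hU x (hKU hx)
    obtain ⟨hxA, hyB⟩ := hX.spine_tooth_of_adj hcomb.toIsBipartiteGraft hpq hxX hx0 hy hxy
    exact ⟨hy, hyB, ⟨x, hxA⟩, hx, Grafts.mem_toothNbrs.2 hxy.symm⟩
  -- If K has no neighbour in G₀, a class within B is still needed, and the class of any tooth of G₀
  -- serves.
  obtain ⟨u, hu0, huN⟩ : ∃ u : B, (u : α) ∈ V(G₀) ∧ (N.Nonempty → (u : α) ∈ N) := by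
    by_cases hne : N.Nonempty
    · obtain ⟨y, hy⟩ := hne
      obtain ⟨hy0, hyB, -⟩ := hNB y hy
      exact ⟨⟨y, hyB⟩, hy0, fun _ => hy⟩
    · obtain ⟨X, hX, hkX, hk0⟩ := hU k hkU
      obtain ⟨u, hu⟩ := hX.exists_tooth hcomb hpq r hG₀ hkX hk0
      exact ⟨u, hu, fun h => absurd h hne⟩
  have huV : (u : α) ∈ V(G) := Grafts.mem_vertexSet_of_mem hG₀ hu0
  refine ⟨{v | v ∈ V(G) ∧ Grafts.KLRel G T u v}, ⟨⟨u, huV, rfl⟩, u, ⟨huV, Or.inl rfl⟩, hu0⟩,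
    ?_, ?_⟩
  · rintro v ⟨-, rfl | ⟨-, hnu⟩⟩
    · exact u.2
    · exact hcomb.mem_tooth_of_nu_toggle hpq hnu
  · intro v hv
    obtain ⟨hv0, hvB, a', ha'K, ha'⟩ := hNB v hv
    obtain ⟨-, _, a, haK, ha⟩ := hNB u (huN ⟨v, hv⟩)
    obtain ⟨c, hc⟩ := hcomb.exists_isCombChoice hpq r
    obtain ⟨S, huS, hS⟩ :=
      (Grafts.IsChoice.tutteCondition hr hc).exists_maximal (Finset.mem_univ u)
    have hvS := hcomb.mem_of_maximal (v := ⟨v, hvB⟩) hpq hE hr hG₀ hU hS huS hu0 hv0 ha ha'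
      (hKU haK) (hlink _ ha'K _ haK)
    refine ⟨Grafts.mem_vertexSet_of_mem hG₀ hv0, ?_⟩
    by_cases huv : u = ⟨v, hvB⟩
    · exact Or.inl (congrArg Subtype.val huv)
    · exact Or.inr ⟨⟨G₀, hG₀, hu0, hv0⟩,
        (hcomb.nu_toggle_le (v := ⟨v, hvB⟩) hpq hE hr hG₀ hu0 hv0).antisymm
          (hcomb.le_nu_toggle hpq hr hS.prop huS hvS huv)⟩
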